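/- Let $d\ge 0$, let $\mathcal K$ be a complex Hilbert space and let $\varepsilon>0$. For $r>0$ let $B_{\mathbb C}(0,r)$ be the set of all $d$-tuples $Z=(Z_1,\dots,Z_d)$ of complex $n\times n$ matrices, of any size $n$, with $\max_i\|Z_i\|<r$ (operator norm), and let $B_{\mathbb R}(0,r)$ be the set of the tuples of Hermitian matrices in it. Words in the noncommuting letters $x_1,\dots,x_d$ are denoted $\alpha,\beta,\dots$, the empty word is $1$, $\beta^*$ is the word $\beta$ reversed, and $Z^\alpha$ is the corresponding product of the $Z_i$. Let $c_\alpha\in\mathcal B(\mathcal K)$ be coefficients such that the series $f(Z)=\sum_\alpha c_\alpha\otimes Z^\alpha\in\mathcal B(\mathcal K\otimes\mathbb C^n)$ converges absolutely at each point of $B_{\mathbb C}(0,1+\varepsilon)$ and uniformly on $B_{\mathbb C}(0,1+\varepsilon)$ (partial sums being taken by word length). Assume that $f$ is matrix monotone on $B_{\mathbb R}(0,1+\varepsilon)$: its values there are self-adjoint, and $f(X)\le f(Y)$ whenever $X,Y\in B_{\mathbb R}(0,1+\varepsilon)$ have the same size and $X_i\le Y_i$ for all $i$. Then for each $i=1,\dots,d$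 the localizing matrix $C_i=[c_{\beta^*x_i\alpha}]_{\beta,\alpha}$ is positive semidefinite, so that \[ \langle \alpha\otimes v,\beta\otimes w\rangle_{\mathcal H_i}=w^*c_{\beta^*x_i\alpha}v\qquad(v,w\in\mathcal K) \] defines a Hilbert space $\mathcal H_i$, the Hausdorff completion of the span of the symbols $\alpha\otimes v$. Let $\mathcal H=\bigoplus_i\mathcal H_i$, let $P_i$ be the orthogonal projection of $\mathcal H$ onto $\mathcal H_i$, write $\alpha\otimes v$ also for the vector of $\mathcal H$ whose component in every $\mathcal H_i$ is $\alpha\otimes v$, and let $Q:\mathcal K\to\mathcal H$, $Qk=1\otimes k$. There is exactly one bounded operator $A$ on $\mathcal H$ with \[ A\,P_j(\alpha\otimes v)=x_j\alpha\otimes v\qquad\text{for all } j,\alpha,v . \] It satisfies $A(\alpha\otimes v)=\sum_i x_i\alpha\otimes v$, it is self-adjoint, and $\|A\|\le 1$. Finally, for every $Z\in B_{\mathbb C}(0,1+\varepsilon)$ whose entries $Z_i$ are all invertible, the operator $A-\sum_iP_iZ_i^{-1}$, that is $A\otimes I_n-\sum_iP_i\otimes Z_i^{-1}$ on $\mathcal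 H\otimes\mathbb C^n$, is invertible and \[ f(Z)=a_0-Q^*\Bigl(A-\sum_iP_iZ_i^{-1}\Bigr)^{-1}Q,\qquad a_0=c_1=f(0), \] where $a_0$ and $Q$ stand for $a_0\otimes I_n$ and $Q\otimes I_n$. -/

import Mathlib

noncomputable section

namespace NCRealization

open scoped Matrix.Norms.L2Operator ComplexOrder

/-- Words in the noncommuting letters `x_1, …, x_d`; the empty word is `1`. -/
abbrev Word (d : ℕ) := FreeMonoid (Fin d)

/-- `d`-tuples of complex `n × n` matrices: level `n` of the matrix universe over `ℝ^d`. -/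
abbrev Tuple (d n : ℕ) := Fin d → Matrix (Fin n) (Fin n) ℂ

/-- The Hilbert space `E ⊗ ℂⁿ`, i.e. the Hilbert direct sum of `n` copies of `E`. -/
abbrev Amp (n : ℕ) (E : Type*) := PiLp 2 (fun _ : Fin n => E)

section Tensor

variable {E F : Type*} [NormedAddCommGroup E] [InnerProductSpace ℂ E]
  [NormedAddCommGroup F] [InnerProductSpace ℂ F] {n : ℕ}

/-- The operator `T ⊗ M : E ⊗ ℂⁿ → F ⊗ ℂⁿ`. -/
def tensor (T : E →L[ℂ] F) (M : Matrix (Fin n) (Fin n) ℂ) : Amp n E →L[ℂ] Amp n F :=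
  (PiLp.continuousLinearEquiv 2 ℂ (fun _ : Fin n => F)).symm.toContinuousLinearMap ∘L
    (ContinuousLinearMap.pi fun j => ∑ k, M j k • (T ∘L ContinuousLinearMap.proj k)) ∘L
    (PiLp.continuousLinearEquiv 2 ℂ (fun _ : Fin n => E)).toContinuousLinearMap

lemma tensor_apply (T : E →L[ℂ] F) (M : Matrix (Fin n) (Fin n) ℂ) (x : Amp n E) (j : Fin n) :
    tensor T M x j = ∑ k, M j k • T (x k) := by
  simp [tensor]

end Tensor

/-- Level `n` of the complex ball `B_ℂ(0, r)`: the norm of a tuple, as a matrix over the operator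
system `ℝ^d`, is the largest of the operator norms of its entries. -/
def complexBall (d : ℕ) (r : ℝ) (n : ℕ) : Set (Tuple d n) :=
  {Z | ∀ i, ‖Z i‖ < r}

/-- Level `n` of the real ball `B_ℝ(0, r)`: the Hermitian tuples in the complex ball. -/
def realBall (d : ℕ) (r : ℝ) (n : ℕ) : Set (Tuple d n) :=
  {X | X ∈ complexBall d r n ∧ ∀ i, (X i).IsHermitian}

variable {d : ℕ} {K : Type*} [NormedAddCommGroup K] [InnerProductSpace ℂ K]

/-- On the sets `G n` of Hermitian tuples, `f` takes self-adjoint values and `X ≤ Y` implies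
`f(X) ≤ f(Y)`. Here `X ≤ Y` means that every `Y i - X i` is positive semidefinite. -/
def MatrixMonotoneOn [CompleteSpace K] (G : ∀ n, Set (Tuple d n))
    (f : ∀ n, Tuple d n → (Amp n K →L[ℂ] Amp n K)) : Prop :=
  (∀ n, ∀ X ∈ G n, IsSelfAdjoint (f n X)) ∧
  ∀ n, ∀ X ∈ G n, ∀ Y ∈ G n, (∀ i, (Y i - X i).PosSemidef) → f n X ≤ f n Y

/-- The term `c_α Z^α` of a noncommutative power series with operator coefficients. -/
def seriesTerm (c : Word d → (K →L[ℂ] K)) {n : ℕ} (Z : Tuple d n) (α : Word d) :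
    Amp n K →L[ℂ] Amp n K :=
  tensor (c α) (FreeMonoid.lift Z α)

/-- The sum of the terms `c_α Z^α` over the words `α` of length less than `N`. -/
def partialSum (c : Word d → (K →L[ℂ] K)) (N : ℕ) {n : ℕ} (Z : Tuple d n) :
    Amp n K →L[ℂ] Amp n K :=
  ∑ k ∈ Finset.range N, ∑ w : Fin k → Fin d, seriesTerm c Z (FreeMonoid.ofList (List.ofFn w))

/-- The series `∑ c_α Z^α` converges absolutely at each point of `B_ℂ(0, r)`, and its partial sums
converge to `f`, uniformly over the points of all levels of `B_ℂ(0, r)`. -/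
def HasPowerSeriesOnComplexBall (c : Word d → (K →L[ℂ] K))
    (f : ∀ n, Tuple d n → (Amp n K →L[ℂ] Amp n K)) (r : ℝ) : Prop :=
  (∀ n, ∀ Z ∈ complexBall d r n, Summable fun α => ‖seriesTerm c Z α‖) ∧
  ∀ δ > 0, ∃ N₀ : ℕ, ∀ N ≥ N₀, ∀ n, ∀ Z ∈ complexBall d r n, ‖f n Z - partialSum c N Z‖ < δ

/-- The `x_i`-localizing matrix, with entry `c_{β* x_i α}` at position `(β, α)`. -/
def localizingMatrix (c : Word d → (K →L[ℂ] K)) (i : Fin d) :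
    Matrix (Word d) (Word d) (K →L[ℂ] K) :=
  Matrix.of fun β α => c (β.reverse * FreeMonoid.of i * α)

variable [CompleteSpace K] (c : Word d → (K →L[ℂ] K))
  [∀ i, Fact (localizingMatrix c i).PosSemidef]

/-- The Hilbert space `H_i`: the Hausdorff completion of the span of the symbols `α ⊗ v` in the
semi-inner product given by the `x_i`-localizing matrix. -/
abbrev Hi (i : Fin d) : Type _ := RKHS.OfKernel (localizingMatrix c i)

/-- The vector `α ⊗ v` of `H_i`, as a bounded linear map of `v`. -/
def symi (i : Fin d) (α : Word d) : K →L[ℂ] Hi c i := RKHS.kerFun (Hi c i) α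

/-- `⟨α ⊗ v, β ⊗ w⟩ = w* c_{β* x_i α} v` in `H_i` (Mathlib's inner product is linear in its second
argument). -/
lemma inner_symi (i : Fin d) (α β : Word d) (v w : K) :
    inner ℂ (symi c i β w) (symi c i α v) =
      inner ℂ w (c (β.reverse * FreeMonoid.of i * α) v) := by
  rw [← inner_conj_symm, symi, symi, ← RKHS.kernel_inner, RKHS.OfKernel.kernel_ofKernel,
    inner_conj_symm]
  rfl

lemma dense_span_symi (i : Fin d) :
    (Submodule.span ℂ {x | ∃ α v, symi c i α v = x}).topologicalClosure = ⊤ :=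
  RKHS.kerFun_dense (Hi c i)

/-- The Hilbert space `H = ⊕ H_i`. -/
abbrev H : Type _ := PiLp 2 (fun i : Fin d => Hi c i)

/-- The orthogonal projection `P_i` of `H` onto the summand `H_i`. -/
def P (i : Fin d) : H c →L[ℂ] H c :=
  (PiLp.continuousLinearEquiv 2 ℂ (fun i : Fin d => Hi c i)).symm.toContinuousLinearMap ∘L
    ContinuousLinearMap.single ℂ (fun i : Fin d => Hi c i) i ∘L
    PiLp.proj 2 (𝕜 := ℂ) (fun i : Fin d => Hi c i) i

lemma P_apply (i : Fin d) (x : H c) (j : Fin d) : P c i x j = if j = i then x j else 0 := by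
  by_cases h : j = i
  · subst h; simp [P]
  · simp [P, h]

/-- The vector `α ⊗ v` of `H`, whose component in every `H_i` is the vector `α ⊗ v` of `H_i`. -/
def sym (α : Word d) : K →L[ℂ] H c :=
  (PiLp.continuousLinearEquiv 2 ℂ (fun i : Fin d => Hi c i)).symm.toContinuousLinearMap ∘L
    ContinuousLinearMap.pi fun i => symi c i α

lemma sym_apply (α : Word d) (v : K) (i : Fin d) : sym c α v i = symi c i α v := rfl

lemma inner_sym (α β : Word d) (v w : K) :
    inner ℂ (sym c β w) (sym c α v) =
      ∑ i, inner ℂ w (c (β.reverse * FreeMonoid.of i * α) v) := by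
  simp only [PiLp.inner_apply, sym_apply, inner_symi]

/-- The map `Q` taking `k ∈ K` to `1 ⊗ k ∈ H`. -/
def Q : K →L[ℂ] H c := sym c 1

/-- `A` acts on `H` as the shift: it maps the vector `α ⊗ v` of the summand `H_j`, which is
`P_j (α ⊗ v)`, to the vector `x_j α ⊗ v` of `H`. As these vectors span a dense subspace of `H`, this
determines the bounded operator `A`. -/
def IsShift (A : H c →L[ℂ] H c) : Prop :=
  ∀ (j : Fin d) (α : Word d) (v : K), A (P c j (sym c α v)) = sym c (FreeMonoid.of j * α) v

/-- The operator `A - ∑ P_i Z_i⁻¹` on `H ⊗ ℂⁿ`. -/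
def pencil (A : H c →L[ℂ] H c) {n : ℕ} (Z : Tuple d n) : Amp n (H c) →L[ℂ] Amp n (H c) :=
  tensor A 1 - ∑ i, tensor (P c i) (Z i)⁻¹

end NCRealization

end

/-! Positivity comes from testing monotonicity on truncated Fock spaces. Let `L` be small multiples
of the creation matrices on words of length at most N, and let `E` be a multiple of the vacuum
projection in slot `i` only. The tuples X = s(L + L*) and Y = X + sE satisfy X ≤ Y, so f(Y) - f(X) ≥
0. Conjugating by diag(s^{-deg}), dividing by s and letting s → 0 leaves the sum of c_w ⊗ L^u E_j
(L*)^v over w = u x_j v (`isPositive_tsum_wordDiff`). By `wordDiff_creation` its entries are powers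
of r times c_{a x_i b*}, which is a weighted truncation of the localizing matrix; the weights scale
away.

The shift is symmetric on formal combinations of symbols, and its matrix coefficients are controlled
by ∑ ‖c_α‖ r^{|α|}, finite for 0 ≤ r < 1 + ε. Symmetry makes k ↦ ‖S^k x‖ log-convex, so growth at
most C r^{-k} forces ‖Sx‖ ≤ ‖x‖/r (`norm_symbolMap_symbolShift_le`). This one bound makes the shift
well defined on H and bounded.

With D = ∑ P_i ⊗ Z_i the pencil is -(1 - AD)D⁻¹, so minus its inverse is ∑ D(AD)^k. Compressing the
k-th term by Q gives the part of f of degree k + 1. -/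

noncomputable section

namespace NCRealization

open scoped Matrix.Norms.L2Operator ComplexOrder
open Filter Topology

/-! ### Algebra and norms of operators T ⊗ M -/

section TensorAlgebra

variable {E F G : Type*} [NormedAddCommGroup E] [InnerProductSpace ℂ E]
  [NormedAddCommGroup F] [InnerProductSpace ℂ F] [NormedAddCommGroup G] [InnerProductSpace ℂ G]
  {n : ℕ}

lemma tensor_add_left (S T : E →L[ℂ] F) (M : Matrix (Fin n) (Fin n) ℂ) :
    tensor (S + T) M = tensor S M + tensor T M := by
  ext x j
  simp [tensor_apply, Finset.sum_add_distrib]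

lemma tensor_add_right (T : E →L[ℂ] F) (M N : Matrix (Fin n) (Fin n) ℂ) :
    tensor T (M + N) = tensor T M + tensor T N := by
  ext x j
  simp [tensor_apply, Finset.sum_add_distrib, add_smul]

lemma tensor_smul_left (a : ℂ) (T : E →L[ℂ] F) (M : Matrix (Fin n) (Fin n) ℂ) :
    tensor (a • T) M = a • tensor T M := by
  ext x j
  simp [tensor_apply, Finset.smul_sum, smul_comm a]

lemma tensor_smul_right (a : ℂ) (T : E →L[ℂ] F) (M : Matrix (Fin n) (Fin n) ℂ) :
    tensor T (a • M) = a • tensor T M := by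
  ext x j
  simp [tensor_apply, Finset.smul_sum, mul_smul]

@[simp] lemma tensor_zero_left (M : Matrix (Fin n) (Fin n) ℂ) :
    tensor (0 : E →L[ℂ] F) M = 0 := by
  ext x j
  simp [tensor_apply]

@[simp] lemma tensor_zero_right (T : E →L[ℂ] F) :
    tensor T (0 : Matrix (Fin n) (Fin n) ℂ) = 0 := by
  ext x j
  simp [tensor_apply]

lemma tensor_sub_right (T : E →L[ℂ] F) (M N : Matrix (Fin n) (Fin n) ℂ) :
    tensor T (M - N) = tensor T M - tensor T N := by
  ext x j
  simp [tensor_apply, Finset.sum_sub_distrib, sub_smul]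

lemma tensor_sum_left {ι : Type*} (s : Finset ι) (T : ι → (E →L[ℂ] F))
    (M : Matrix (Fin n) (Fin n) ℂ) : tensor (∑ i ∈ s, T i) M = ∑ i ∈ s, tensor (T i) M := by
  classical
  induction s using Finset.induction_on with
  | empty => simp
  | insert a s ha ih => rw [Finset.sum_insert ha, Finset.sum_insert ha, tensor_add_left, ih]

@[simp] lemma tensor_one_one : tensor (1 : E →L[ℂ] E) (1 : Matrix (Fin n) (Fin n) ℂ) = 1 := by
  ext x j
  simp [tensor_apply, Matrix.one_apply]

lemma tensor_comp (S : F →L[ℂ] G) (T : E →L[ℂ] F) (M N : Matrix (Fin n) (Fin n) ℂ) :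
    tensor (S ∘L T) (M * N) = tensor S M ∘L tensor T N := by
  ext x j
  simp only [tensor_apply, ContinuousLinearMap.comp_apply, Matrix.mul_apply, map_sum, map_smul,
    Finset.smul_sum, smul_smul, Finset.sum_smul]
  exact Finset.sum_comm

lemma tensor_mul (S T : E →L[ℂ] E) (M N : Matrix (Fin n) (Fin n) ℂ) :
    tensor (S * T) (M * N) = tensor S M * tensor T N :=
  tensor_comp S T M N

lemma adjoint_tensor [CompleteSpace E] [CompleteSpace F] (T : E →L[ℂ] F)
    (M : Matrix (Fin n) (Fin n) ℂ) : (tensor T M).adjoint = tensor T.adjoint M.conjTranspose := by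
  symm
  rw [ContinuousLinearMap.eq_adjoint_iff]
  intro x y
  simp only [PiLp.inner_apply, tensor_apply, sum_inner, inner_sum, inner_smul_left,
    inner_smul_right, ContinuousLinearMap.adjoint_inner_left, Matrix.conjTranspose_apply,
    RCLike.star_def, RingHomCompTriple.comp_apply, RingHom.id_apply]
  rw [Finset.sum_comm]

lemma star_tensor [CompleteSpace E] (T : E →L[ℂ] E) (M : Matrix (Fin n) (Fin n) ℂ) :
    star (tensor T M) = tensor (star T) (star M) :=
  adjoint_tensor T M

/-- `T ↦ T ⊗ 1` as a star homomorphism. -/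
def tensorLeftHom (n : ℕ) (E : Type*) [NormedAddCommGroup E] [InnerProductSpace ℂ E]
    [CompleteSpace E] : (E →L[ℂ] E) →⋆ₙₐ[ℂ] (Amp n E →L[ℂ] Amp n E) where
  toFun T := tensor T 1
  map_smul' a T := tensor_smul_left a T 1
  map_zero' := tensor_zero_left 1
  map_add' S T := tensor_add_left S T 1
  map_mul' S T := by rw [← tensor_mul, one_mul]
  map_star' T := by rw [star_tensor, star_one]

/-- `Z ↦ ∑ p_i ⊗ Z_i` as a star homomorphism, for pairwise orthogonal projections `p_i`. -/
def tensorProjHom {ι : Type*} [Fintype ι] [DecidableEq ι] [CompleteSpace E] (n : ℕ)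
    (p : ι → (E →L[ℂ] E)) (hp : ∀ i j, p i * p j = if i = j then p i else 0)
    (hs : ∀ i, star (p i) = p i) :
    (ι → Matrix (Fin n) (Fin n) ℂ) →⋆ₙₐ[ℂ] (Amp n E →L[ℂ] Amp n E) where
  toFun Z := ∑ i, tensor (p i) (Z i)
  map_smul' a Z := by simp [tensor_smul_right, Finset.smul_sum]
  map_zero' := by simp
  map_add' Z W := by simp [tensor_add_right, Finset.sum_add_distrib]
  map_mul' Z W := by
    simp only [Finset.sum_mul_sum, ← tensor_mul, hp, Pi.mul_apply]
    refine Finset.sum_congr rfl fun i _ => ?_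
    rw [Finset.sum_eq_single i]
    · simp
    · intro j _ hj
      simp [hj.symm]
    · simp
  map_star' Z := by
    refine Eq.trans ?_ (map_sum (ContinuousLinearMap.adjoint (𝕜 := ℂ)) _ _).symm
    exact Finset.sum_congr rfl fun i _ => by
      rw [adjoint_tensor, ← ContinuousLinearMap.star_eq_adjoint, hs]
      rfl

/-- Star homomorphisms of C*-algebras are contractive; the tensor norm bounds below rest on this. -/
lemma norm_tensor_one_right_le [CompleteSpace E] (T : E →L[ℂ] E) :
    ‖tensor T (1 : Matrix (Fin n) (Fin n) ℂ)‖ ≤ ‖T‖ :=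
  NonUnitalStarAlgHom.norm_apply_le (tensorLeftHom n E) T

lemma norm_sum_tensor_proj_le {ι : Type*} [Fintype ι] [DecidableEq ι] [CompleteSpace E]
    (p : ι → (E →L[ℂ] E)) (hp : ∀ i j, p i * p j = if i = j then p i else 0)
    (hs : ∀ i, star (p i) = p i) (Z : ι → Matrix (Fin n) (Fin n) ℂ) :
    ‖∑ i, tensor (p i) (Z i)‖ ≤ ‖Z‖ :=
  NonUnitalStarAlgHom.norm_apply_le (tensorProjHom n p hp hs) Z

lemma norm_tensor_one_left_le [CompleteSpace E] (M : Matrix (Fin n) (Fin n) ℂ) :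
    ‖tensor (1 : E →L[ℂ] E) M‖ ≤ ‖M‖ := by
  have h := norm_sum_tensor_proj_le (E := E) (n := n) (fun _ : Unit => 1) (by simp) (by simp)
    (fun _ => M)
  simpa [Pi.norm_def] using h

lemma norm_tensor_le [CompleteSpace E] (T : E →L[ℂ] E) (M : Matrix (Fin n) (Fin n) ℂ) :
    ‖tensor T M‖ ≤ ‖T‖ * ‖M‖ := by
  have h : tensor T M = tensor T 1 * tensor 1 M := by rw [← tensor_mul, mul_one, one_mul]
  rw [h]
  exact (norm_mul_le _ _).trans (mul_le_mul (norm_tensor_one_right_le T)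
    (norm_tensor_one_left_le M) (norm_nonneg _) (norm_nonneg _))

/-- For fixed `T`, the map `M ↦ T ⊗ M` is continuous. -/
lemma continuous_tensor [CompleteSpace E] (T : E →L[ℂ] E) :
    Continuous fun M : Matrix (Fin n) (Fin n) ℂ => tensor T M := by
  let l : Matrix (Fin n) (Fin n) ℂ →ₗ[ℂ] (Amp n E →L[ℂ] Amp n E) :=
    { toFun := tensor T
      map_add' := tensor_add_right T
      map_smul' := fun a M => tensor_smul_right a T M }
  exact (l.mkContinuous ‖T‖ (norm_tensor_le T)).continuous

lemma norm_le_norm_tensor_smul_one (T : E →L[ℂ] E) (a : ℂ) :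
    ‖a‖ * ‖T‖ ≤ ‖tensor T (a • (1 : Matrix (Fin 1) (Fin 1) ℂ))‖ := by
  rw [← norm_smul]
  refine ContinuousLinearMap.opNorm_le_bound _ (ContinuousLinearMap.opNorm_nonneg _) fun v => ?_
  have h := (tensor T (a • (1 : Matrix (Fin 1) (Fin 1) ℂ))).le_opNorm
    (WithLp.toLp 2 (fun _ => v))
  simpa [PiLp.norm_eq_of_L2, tensor_apply] using h

end TensorAlgebra

/-! ### Coefficient bounds and regrouping of the series -/

section Series

variable {d : ℕ} {K : Type*} [NormedAddCommGroup K] [InnerProductSpace ℂ K]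
  {c : Word d → (K →L[ℂ] K)} {f : ∀ n, Tuple d n → (Amp n K →L[ℂ] Amp n K)} {R : ℝ}

/-- Words, sorted by their length. -/
def sigmaEquivWord (d : ℕ) : (Σ k, Fin k → Fin d) ≃ Word d :=
  List.equivSigmaTuple.symm.trans FreeMonoid.ofList

lemma length_ofList_ofFn (k : ℕ) (w : Fin k → Fin d) :
    (FreeMonoid.ofList (List.ofFn w)).length = k := by
  simp [FreeMonoid.length]

lemma lift_smul_one {n : ℕ} (a : ℂ) (α : Word d) :
    FreeMonoid.lift (fun _ : Fin d => a • (1 : Matrix (Fin n) (Fin n) ℂ)) α =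
      a ^ α.length • 1 := by
  induction α using FreeMonoid.recOn with
  | one => simp
  | of_mul x xs h => simp [h, pow_add, smul_smul, mul_comm]

/-- The coefficients of a power series that converges absolutely on `B_ℂ(0, R)` are summable with
the weights `r ^ |α|`, for every `r < R`. -/
lemma HasPowerSeriesOnComplexBall.summable_norm_coeff (h : HasPowerSeriesOnComplexBall c f R)
    {r : ℝ} (hr : 0 ≤ r) (hrR : r < R) : Summable fun α => ‖c α‖ * r ^ α.length := by
  -- At the scalar 1 × 1 tuple r, every word of length k evaluates to r^k.
  have hZ : (fun _ => (r : ℂ) • (1 : Matrix (Fin 1) (Fin 1) ℂ)) ∈ complexBall d R 1 := by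
    intro i
    rw [norm_smul, norm_one, mul_one, Complex.norm_real, Real.norm_of_nonneg hr]
    exact hrR
  refine (h.1 1 _ hZ).of_nonneg_of_le (fun α => by positivity) fun α => ?_
  have h1 := norm_le_norm_tensor_smul_one (c α) ((r : ℂ) ^ α.length)
  rw [seriesTerm, lift_smul_one]
  rw [norm_pow, Complex.norm_real, Real.norm_of_nonneg hr, mul_comm] at h1
  exact h1

variable [CompleteSpace K]

/-- Absolute convergence gives an unconditional sum; grouping it by length identifies its value with
the limit `f` of the partial sums. -/
lemma HasPowerSeriesOnComplexBall.hasSum_seriesTerm (h : HasPowerSeriesOnComplexBall c f R)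
    {n : ℕ} {Z : Tuple d n} (hZ : Z ∈ complexBall d R n) :
    HasSum (seriesTerm c Z) (f n Z) := by
  have hs : Summable (seriesTerm c Z) := (h.1 n Z hZ).of_norm
  have hg := ((sigmaEquivWord d).hasSum_iff.mpr hs.hasSum).sigma fun k => hasSum_fintype _
  have h1 : Tendsto (fun N => partialSum c N Z) atTop (𝓝 (∑' α, seriesTerm c Z α)) :=
    hg.tendsto_sum_nat
  have h2 : Tendsto (fun N => partialSum c N Z) atTop (𝓝 (f n Z)) := by
    rw [Metric.tendsto_atTop]
    intro δ hδ
    obtain ⟨N₀, hN₀⟩ := h.2 δ hδ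
    refine ⟨N₀, fun N hN => ?_⟩
    rw [dist_comm, dist_eq_norm]
    exact hN₀ N hN n Z hZ
  rw [← tendsto_nhds_unique h1 h2]
  exact hs.hasSum

lemma HasPowerSeriesOnComplexBall.hasSum_homogeneous (h : HasPowerSeriesOnComplexBall c f R)
    {n : ℕ} {Z : Tuple d n} (hZ : Z ∈ complexBall d R n) :
    HasSum (fun k => ∑ w : Fin k → Fin d, seriesTerm c Z (FreeMonoid.ofList (List.ofFn w)))
      (f n Z) :=
  ((sigmaEquivWord d).hasSum_iff.mpr (h.hasSum_seriesTerm hZ)).sigma fun _ => hasSum_fintype _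

end Series

/-! ### Difference quotients of words -/

section WordDifference

variable {d n : ℕ}

/-- The noncommutative difference-differential `∑_{w = u x_j v} A^u E_j B^v`. -/
def wordDiff (A E B : Tuple d n) (w : Word d) : Matrix (Fin n) (Fin n) ℂ :=
  FreeMonoid.recOn w 0 fun j v D => E j * FreeMonoid.lift B v + A j * D

@[simp] lemma wordDiff_one (A E B : Tuple d n) : wordDiff A E B 1 = 0 := rfl

lemma wordDiff_of_mul (A E B : Tuple d n) (j : Fin d) (v : Word d) :
    wordDiff A E B (FreeMonoid.of j * v) =
      E j * FreeMonoid.lift B v + A j * wordDiff A E B v := rfl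

lemma mul_lift_of_intertwine {X B : Tuple d n} {D : Matrix (Fin n) (Fin n) ℂ}
    (h : ∀ j, X j * D = D * B j) (w : Word d) :
    FreeMonoid.lift X w * D = D * FreeMonoid.lift B w := by
  induction w using FreeMonoid.recOn with
  | one => simp
  | of_mul j v ih =>
    simp only [map_mul, FreeMonoid.lift_eval_of]
    rw [mul_assoc, ih, ← mul_assoc, h, mul_assoc]

/-- Finite differences of words along intertwined tuples. -/
lemma mul_sub_mul_eq_smul_wordDiff {X Y E A B : Tuple d n} {D : Matrix (Fin n) (Fin n) ℂ} {s : ℂ}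
    (hY : ∀ j, Y j = X j + s • E j) (hA : ∀ j, D * Y j = A j * D) (hB : ∀ j, X j * D = D * B j)
    (hE : ∀ j, D * E j * D = E j) (w : Word d) :
    D * (FreeMonoid.lift Y w - FreeMonoid.lift X w) * D = s • wordDiff A E B w := by
  induction w using FreeMonoid.recOn with
  | one => simp
  | of_mul j v ih =>
    -- Product rule: the left `D` passes through copies of `Y`, turning them into `A`, and the right
    -- `D` through copies of `X`, turning them into `B`.
    have h1 : FreeMonoid.lift Y (FreeMonoid.of j * v) - FreeMonoid.lift X (FreeMonoid.of j * v) =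
        Y j * (FreeMonoid.lift Y v - FreeMonoid.lift X v) + s • (E j * FreeMonoid.lift X v) := by
      simp only [map_mul, FreeMonoid.lift_eval_of]
      rw [mul_sub, ← smul_mul_assoc, ← sub_eq_iff_eq_add'.mpr (hY j)]
      noncomm_ring
    have h2 : D * (E j * FreeMonoid.lift X v) * D = E j * FreeMonoid.lift B v := by
      rw [mul_assoc, mul_assoc, mul_lift_of_intertwine hB, ← mul_assoc, ← mul_assoc, hE]
    rw [h1, mul_add, add_mul, ← mul_assoc, hA, mul_assoc, mul_assoc, ← mul_assoc D, ih,
      mul_smul_comm, mul_smul_comm, smul_mul_assoc, h2, wordDiff_of_mul, smul_add, add_comm]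

lemma norm_lift_le_one [Nonempty (Fin n)] {B : Tuple d n} (hB : ∀ j, ‖B j‖ ≤ 1) (w : Word d) :
    ‖FreeMonoid.lift B w‖ ≤ 1 := by
  induction w using FreeMonoid.recOn with
  | one => rw [map_one, norm_one]
  | of_mul j v ih =>
    rw [map_mul, FreeMonoid.lift_eval_of]
    exact (norm_mul_le _ _).trans (mul_le_one₀ (hB j) (norm_nonneg _) ih)

/-- The number of terms grows with the word, but the recursion is bounded by 1/2 · 1 + 1/2 · 1, so
the bound is uniform in length. -/
lemma norm_wordDiff_le_one [Nonempty (Fin n)] {A E B : Tuple d n} (hA : ∀ j, ‖A j‖ ≤ 1 / 2)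
    (hE : ∀ j, ‖E j‖ ≤ 1 / 2) (hB : ∀ j, ‖B j‖ ≤ 1) (w : Word d) : ‖wordDiff A E B w‖ ≤ 1 := by
  induction w using FreeMonoid.recOn with
  | one => simp
  | of_mul j v ih =>
    rw [wordDiff_of_mul]
    have h1 : ‖E j * FreeMonoid.lift B v‖ ≤ 1 / 2 * 1 := (norm_mul_le _ _).trans
      (mul_le_mul (hE j) (norm_lift_le_one hB v) (norm_nonneg _) (by norm_num))
    have h2 : ‖A j * wordDiff A E B v‖ ≤ 1 / 2 * 1 := (norm_mul_le _ _).trans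
      (mul_le_mul (hA j) ih (norm_nonneg _) (by norm_num))
    linarith [norm_add_le (E j * FreeMonoid.lift B v) (A j * wordDiff A E B v)]

lemma continuous_lift {T : Type*} [TopologicalSpace T] {B : T → Tuple d n} (hB : Continuous B)
    (w : Word d) : Continuous fun t => FreeMonoid.lift (B t) w := by
  induction w using FreeMonoid.recOn with
  | one => simpa using continuous_const
  | of_mul j v ih =>
    simp only [map_mul, FreeMonoid.lift_eval_of]
    exact ((continuous_apply j).comp hB).mul ih

lemma continuous_wordDiff {T : Type*} [TopologicalSpace T] {A B : T → Tuple d n} (E : Tuple d n)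
    (hA : Continuous A) (hB : Continuous B) (w : Word d) :
    Continuous fun t => wordDiff (A t) E (B t) w := by
  induction w using FreeMonoid.recOn with
  | one => simpa using continuous_const
  | of_mul j v ih =>
    simp only [wordDiff_of_mul]
    exact (continuous_const.mul (continuous_lift hB v)).add
      (((continuous_apply j).comp hA).mul ih)

end WordDifference

/-! ### Monotonicity along graded perturbations -/

section Graded

variable {d n : ℕ} {K : Type*} [NormedAddCommGroup K] [InnerProductSpace ℂ K]
  {c : Word d → (K →L[ℂ] K)} {f : ∀ n, Tuple d n → (Amp n K →L[ℂ] Amp n K)}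

lemma isPositive_of_tendsto {E : Type*} [NormedAddCommGroup E] [InnerProductSpace ℂ E]
    {ι : Type*} {l : Filter ι} [l.NeBot] {T : ι → (E →L[ℂ] E)} {S : E →L[ℂ] E}
    (h : Tendsto T l (𝓝 S)) (hT : ∀ᶠ t in l, (T t).IsPositive) : S.IsPositive := by
  have hap : ∀ x, Tendsto (fun t => T t x) l (𝓝 (S x)) := fun x =>
    ((ContinuousLinearMap.apply ℂ E x).continuous.tendsto S).comp h
  rw [ContinuousLinearMap.isPositive_def]
  constructor
  · intro x y
    refine tendsto_nhds_unique_of_eventuallyEq ((hap x).inner tendsto_const_nhds)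
      (tendsto_const_nhds.inner (hap y)) ?_
    filter_upwards [hT] with t ht using ht.isSymmetric x y
  · intro x
    refine ge_of_tendsto ((RCLike.continuous_re.tendsto _).comp
      ((hap x).inner tendsto_const_nhds)) ?_
    filter_upwards [hT] with t ht using ht.re_inner_nonneg_left x

/-- Let `L` be a tuple of matrices that raise a degree by one and `E` positive semidefinite matrices
acting on degree zero. Matrix monotonicity along `s (L + L*) + s E`, after rescaling by the degree
and letting `s` tend to `0`, gives positivity of the derivative at `(L, L*)`. -/
lemma isPositive_tsum_wordDiff [CompleteSpace K] [Nonempty (Fin n)] {ε : ℝ} (hε : 0 < ε)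
    (hmono : MatrixMonotoneOn (realBall d (1 + ε)) f)
    (hseries : HasPowerSeriesOnComplexBall c f (1 + ε)) (deg : Fin n → ℕ) (L E : Tuple d n)
    (hL : ∀ j a b, L j a b ≠ 0 → deg a = deg b + 1)
    (hE : ∀ j a b, E j a b ≠ 0 → deg a = 0 ∧ deg b = 0)
    (hpos : ∀ j, (E j).PosSemidef) (hLn : ∀ j, ‖L j‖ ≤ 1 / 8) (hEn : ∀ j, ‖E j‖ ≤ 1 / 8) :
    Summable (fun w => tensor (c w) (wordDiff L E (fun j => (L j).conjTranspose) w)) ∧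
    (∑' w, tensor (c w) (wordDiff L E (fun j => (L j).conjTranspose) w)).IsPositive := by
  have hc : Summable fun w => ‖c w‖ := by
    simpa using hseries.summable_norm_coeff zero_le_one (by linarith)
  set L' : Tuple d n := fun j => (L j).conjTranspose with hL'
  have hL'n : ∀ j, ‖L' j‖ ≤ 1 / 8 := fun j => by
    rw [hL', Matrix.l2_opNorm_conjTranspose]
    exact hLn j
  -- These are D Y D⁻¹ and D⁻¹ X D for the `X`, `Y`, `D` below. The rescaling is chosen so that both
  -- have limits, `L` and `L*`, as s → 0.
  let A : ℝ → Tuple d n := fun s j => L j + ((s : ℂ) ^ 2) • L' j + (s : ℂ) • E j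
  let B : ℝ → Tuple d n := fun s j => ((s : ℂ) ^ 2) • L j + L' j
  have hA : Continuous A := by fun_prop
  have hB : Continuous B := by fun_prop
  have hA0 : A 0 = L := by ext; simp [A]
  have hB0 : B 0 = L' := by ext; simp [B]
  have hsn : ∀ s : ℝ, 0 ≤ s → s ≤ 1 → ∀ M : Matrix (Fin n) (Fin n) ℂ, ‖M‖ ≤ 1 / 8 →
      ‖(s : ℂ) • M‖ ≤ 1 / 8 := by
    intro s hs0 hs1 M hM
    rw [norm_smul, Complex.norm_real, Real.norm_of_nonneg hs0]
    nlinarith [norm_nonneg M]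
  have hsn2 : ∀ s : ℝ, 0 ≤ s → s ≤ 1 → ∀ M : Matrix (Fin n) (Fin n) ℂ, ‖M‖ ≤ 1 / 8 →
      ‖(s : ℂ) ^ 2 • M‖ ≤ 1 / 8 := by
    intro s hs0 hs1 M hM
    rw [pow_two, mul_smul]
    exact hsn s hs0 hs1 _ (hsn s hs0 hs1 M hM)
  -- With all pieces at most 1/8, `A s` has norm at most 3/8 and `B s` at most 1/4. The domination
  -- by ‖c w‖ is uniform in s, which allows the limit under the sum.
  have hbound : ∀ s : ℝ, 0 ≤ s → s ≤ 1 → ∀ w,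
      ‖tensor (c w) (wordDiff (A s) E (B s) w)‖ ≤ ‖c w‖ := by
    intro s hs0 hs1 w
    refine (norm_tensor_le _ _).trans (mul_le_of_le_one_right (norm_nonneg _) ?_)
    refine norm_wordDiff_le_one (fun j => ?_) (fun j => (hEn j).trans (by norm_num))
      (fun j => ?_) w
    · have h1 := norm_add₃_le (a := L j) (b := (s : ℂ) ^ 2 • L' j) (c := (s : ℂ) • E j)
      linarith [hLn j, hsn2 s hs0 hs1 _ (hL'n j), hsn s hs0 hs1 _ (hEn j)]
    · have h1 := norm_add_le ((s : ℂ) ^ 2 • L j) (L' j)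
      linarith [hL'n j, hsn2 s hs0 hs1 _ (hLn j)]
  have hsum0 : Summable (fun w => tensor (c w) (wordDiff L E L' w)) := by
    refine Summable.of_norm_bounded hc fun w => ?_
    have := hbound 0 le_rfl zero_le_one w
    rwa [hA0, hB0] at this
  refine ⟨hsum0, ?_⟩
  have hIoc : ∀ᶠ s : ℝ in 𝓝[>] 0, 0 < s ∧ s ≤ 1 := by
    filter_upwards [Ioc_mem_nhdsGT (zero_lt_one (α := ℝ))] with s hs using hs
  have hlim : Tendsto (fun s => ∑' w, tensor (c w) (wordDiff (A s) E (B s) w)) (𝓝[>] 0)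
      (𝓝 (∑' w, tensor (c w) (wordDiff L E L' w))) := by
    refine tendsto_tsum_of_dominated_convergence hc (fun w => ?_) ?_
    · have h := ((continuous_tensor (c w)).comp (continuous_wordDiff E hA hB w)).tendsto 0
      simp only [Function.comp_apply, hA0, hB0] at h
      exact h.mono_left nhdsWithin_le_nhds
    · filter_upwards [hIoc] with s hs w using hbound s hs.1.le hs.2 w
  refine isPositive_of_tendsto hlim ?_
  filter_upwards [hIoc] with s ⟨hs0, hs1⟩
  have hsC : (s : ℂ) ≠ 0 := by exact_mod_cast hs0.ne'
  let X : Tuple d n := fun j => (s : ℂ) • (L j + L' j)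
  let Y : Tuple d n := fun j => X j + (s : ℂ) • E j
  let D : Matrix (Fin n) (Fin n) ℂ := Matrix.diagonal fun a => ((s : ℂ) ^ deg a)⁻¹
  have hDs : D.conjTranspose = D := by
    simp [D, Matrix.diagonal_conjTranspose, Pi.star_def]
  have hXh : ∀ j, (X j).IsHermitian := by
    intro j
    simp only [X, hL', Matrix.IsHermitian, Matrix.conjTranspose_smul, Matrix.conjTranspose_add,
      Matrix.conjTranspose_conjTranspose, RCLike.star_def, Complex.conj_ofReal]
    rw [add_comm]
  have hXn : ∀ j, ‖X j‖ ≤ 1 / 4 := by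
    intro j
    have h1 := norm_add_le ((s : ℂ) • L j) ((s : ℂ) • L' j)
    rw [← smul_add] at h1
    linarith [hsn s hs0.le hs1 _ (hLn j), hsn s hs0.le hs1 _ (hL'n j)]
  have hXb : X ∈ realBall d (1 + ε) n := ⟨fun j => by linarith [hXn j], hXh⟩
  have hEs : ∀ j, ((s : ℂ) • E j).PosSemidef := fun j =>
    (hpos j).smul (by exact_mod_cast hs0.le)
  have hYb : Y ∈ realBall d (1 + ε) n := by
    refine ⟨fun j => ?_, fun j => (hXh j).add (hEs j).1⟩
    linarith [norm_add_le (X j) ((s : ℂ) • E j), hXn j, hsn s hs0.le hs1 _ (hEn j)]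
  have hXD : ∀ j, X j * D = D * B s j := by
    intro j
    ext a b
    simp only [X, D, B, Matrix.mul_diagonal, Matrix.diagonal_mul, Matrix.smul_apply,
      Matrix.add_apply, smul_eq_mul]
    have h1 : (s : ℂ) * L j a b * ((s : ℂ) ^ deg b)⁻¹ =
        ((s : ℂ) ^ deg a)⁻¹ * (s ^ 2 * L j a b) := by
      by_cases h : L j a b = 0
      · simp [h]
      · rw [hL j a b h]
        field_simp
        ring
    have h2 : (s : ℂ) * L' j a b * ((s : ℂ) ^ deg b)⁻¹ = ((s : ℂ) ^ deg a)⁻¹ * L' j a b := by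
      by_cases h : L j b a = 0
      · simp [hL', h]
      · rw [hL j b a h]
        field_simp
        ring
    rw [mul_add, mul_add, add_mul, h1, h2]
  have hDE : ∀ j, D * E j = E j := by
    intro j
    ext a b
    simp only [D, Matrix.diagonal_mul]
    by_cases h : E j a b = 0
    · simp [h]
    · simp [(hE j a b h).1]
  have hED : ∀ j, E j * D = E j := by
    intro j
    have h := congrArg Matrix.conjTranspose (hDE j)
    rwa [Matrix.conjTranspose_mul, hDs, (hpos j).1] at h
  have hDY : ∀ j, D * Y j = A s j * D := by
    intro j
    have h := congrArg Matrix.conjTranspose (hXD j)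
    rw [Matrix.conjTranspose_mul, Matrix.conjTranspose_mul, hDs, hXh j] at h
    have hBA : (B s j).conjTranspose = L j + (s : ℂ) ^ 2 • L' j := by
      simp [B, hL', add_comm, Matrix.conjTranspose_smul]
    rw [hBA] at h
    simp only [Y, A]
    rw [mul_add, h, add_mul _ (_ • E j), mul_smul_comm, smul_mul_assoc _ (E j), hDE, hED]
  have hid := mul_sub_mul_eq_smul_wordDiff (X := X) (Y := Y) (E := E) (A := A s) (B := B s)
    (D := D) (s := s) (fun j => rfl) hDY hXD (fun j => by rw [hDE, hED])
  have hfsum := (hseries.hasSum_seriesTerm hYb.1).sub (hseries.hasSum_seriesTerm hXb.1)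
  -- Multiplying by the self-adjoint D ⊗ 1 on both sides and dividing by s > 0 preserves positivity.
  have hconj := ((hfsum.mul_left (tensor 1 D)).mul_right (tensor 1 D)).const_smul (s : ℂ)⁻¹
  have hterm : ∀ w, (s : ℂ)⁻¹ • (tensor 1 D * (seriesTerm c Y w - seriesTerm c X w) * tensor 1 D) =
      tensor (c w) (wordDiff (A s) E (B s) w) := by
    intro w
    rw [seriesTerm, seriesTerm, ← tensor_sub_right, ← tensor_mul, ← tensor_mul, hid, one_mul,
      mul_one, tensor_smul_right, smul_smul, inv_mul_cancel₀ hsC, one_smul]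
  simp only [hterm] at hconj
  rw [hconj.tsum_eq]
  have hle : (f n Y - f n X).IsPositive :=
    hmono.2 n X hXb Y hYb fun j => by simpa [Y] using hEs j
  have hp := hle.conj_adjoint (tensor (1 : K →L[ℂ] K) D)
  rw [adjoint_tensor, hDs] at hp
  have h1 : (1 : K →L[ℂ] K).adjoint = 1 := star_one _
  rw [h1] at hp
  refine ContinuousLinearMap.IsPositive.smul_of_nonneg hp ?_
  exact_mod_cast (inv_pos.mpr hs0).le

end Graded

/-! ### Creation matrices on a truncated Fock space -/

section Fock

open scoped Classical

variable {d n : ℕ}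

/-- The creation matrices on the span of the words `g a`, scaled by `r`. -/
def creation (r : ℝ) (g : Fin n → Word d) : Tuple d n :=
  fun j => Matrix.of fun a b => if g a = FreeMonoid.of j * g b then (r : ℂ) else 0

/-- The tuple with `r` times the projection to the vacuum at the letter `i`. -/
def vacuum (r : ℝ) (g : Fin n → Word d) (i : Fin d) : Tuple d n :=
  fun j => Matrix.of fun a b => if j = i ∧ g a = 1 ∧ g b = 1 then (r : ℂ) else 0

lemma of_mul_eq_of_mul_iff (j k : Fin d) (u v : Word d) :
    FreeMonoid.of j * u = FreeMonoid.of k * v ↔ j = k ∧ u = v :=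
  List.cons_eq_cons

lemma exists_enum_words (d N : ℕ) : ∃ (n : ℕ) (g : Fin n → Word d), Function.Injective g ∧
    ∀ w, w ∈ Set.range g ↔ w.length ≤ N := by
  have hfin : {w : Word d | w.length ≤ N}.Finite := List.finite_length_le (Fin d) N
  have := hfin.to_subtype
  obtain ⟨n, ⟨e⟩⟩ := Finite.exists_equiv_fin {w : Word d | w.length ≤ N}
  refine ⟨n, fun a => (e.symm a : Word d), Subtype.val_injective.comp e.symm.injective,
    fun w => ⟨?_, fun hw => ⟨e ⟨w, hw⟩, by simp⟩⟩⟩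
  rintro ⟨a, rfl⟩
  exact (e.symm a).2

lemma creation_apply (r : ℝ) (g : Fin n → Word d) (j : Fin d) (a b : Fin n) :
    creation r g j a b = if g a = FreeMonoid.of j * g b then (r : ℂ) else 0 := rfl

lemma creation_smul (r : ℝ) (g : Fin n → Word d) (j : Fin d) :
    creation r g j = (r : ℂ) • creation 1 g j := by
  ext a b
  simp [creation]

lemma vacuum_smul (r : ℝ) (g : Fin n → Word d) (i j : Fin d) :
    vacuum r g i j = (r : ℂ) • vacuum 1 g i j := by
  ext a b
  simp [vacuum]

lemma posSemidef_vacuum {r : ℝ} (hr : 0 ≤ r) (g : Fin n → Word d) (i j : Fin d) :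
    (vacuum r g i j).PosSemidef := by
  rw [vacuum_smul]
  refine Matrix.PosSemidef.smul ?_ (by exact_mod_cast hr)
  have h : vacuum 1 g i j = Matrix.vecMulVec (fun a => if j = i ∧ g a = 1 then (1 : ℂ) else 0)
      (star fun a => if j = i ∧ g a = 1 then (1 : ℂ) else 0) := by
    ext a b
    simp only [vacuum, Matrix.vecMulVec_apply, Matrix.of_apply, Pi.star_apply]
    by_cases h1 : j = i <;> by_cases h2 : g a = 1 <;> by_cases h3 : g b = 1 <;> simp [h1, h2, h3]
  rw [h]
  exact Matrix.posSemidef_vecMulVec_self_star _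

variable {g : Fin n → Word d}

/-- Adjoints of creation matrices strip leading letters. Closure under suffixes keeps every
intermediate word in the enumeration, so truncation loses nothing. -/
lemma lift_conjTranspose_creation (hg : Function.Injective g)
    (hsuffix : ∀ u v, u * v ∈ Set.range g → v ∈ Set.range g) (r : ℝ) (w : Word d) (a b : Fin n) :
    FreeMonoid.lift (fun j => (creation r g j).conjTranspose) w a b =
      if g b = w.reverse * g a then (r : ℂ) ^ w.length else 0 := by
  induction w using FreeMonoid.recOn generalizing a with
  | one =>
    simp only [map_one, Matrix.one_apply, FreeMonoid.length_one, pow_zero]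
    refine if_congr ?_ rfl rfl
    exact ⟨fun h => by rw [h]; rfl, fun h => (hg h).symm⟩
  | of_mul j v ih =>
    simp only [map_mul, FreeMonoid.lift_eval_of, Matrix.mul_apply, ih, Matrix.conjTranspose_apply,
      creation_apply, FreeMonoid.reverse_mul, FreeMonoid.reverse_of, mul_assoc,
      FreeMonoid.length_mul, FreeMonoid.length_of]
    by_cases hx : FreeMonoid.of j * g a ∈ Set.range g
    · obtain ⟨c, hc⟩ := hx
      rw [Finset.sum_eq_single c]
      · rw [hc, if_pos rfl]
        split_ifs <;> simp [pow_add]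
      · intro c' _ hcc'
        rw [if_neg, star_zero, zero_mul]
        exact fun h => hcc' (hg (h.trans hc.symm))
      · simp
    · rw [if_neg]
      · refine Finset.sum_eq_zero fun c _ => ?_
        rw [if_neg, star_zero, zero_mul]
        exact fun h => hx ⟨c, h⟩
      · exact fun h => hx (hsuffix _ _ ⟨b, h⟩)

/-- In a splitting w = u x_j v, the factor (L*)^v must bring `g b` down to the vacuum, `E` forces j
= i, and L^u must build `g a` from the vacuum. So exactly one splitting of one word contributes to
each entry. -/
lemma wordDiff_creation (hg : Function.Injective g)
    (hsuffix : ∀ u v, u * v ∈ Set.range g → v ∈ Set.range g) (r : ℝ) (i : Fin d) (w : Word d)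
    (a b : Fin n) :
    wordDiff (creation r g) (vacuum r g i) (fun j => (creation r g j).conjTranspose) w a b =
      if w = g a * (FreeMonoid.of i * (g b).reverse) then (r : ℂ) ^ w.length else 0 := by
  obtain ⟨o, ho⟩ : (1 : Word d) ∈ Set.range g := hsuffix (g a) 1 ⟨a, by simp⟩
  -- The contribution of the splitting at the first letter, where u is empty.
  have hE : ∀ (j : Fin d) (v : Word d) (a : Fin n), (vacuum r g i j *
      FreeMonoid.lift (fun j => (creation r g j).conjTranspose) v) a b =
      if j = i ∧ g a = 1 ∧ v = (g b).reverse then (r : ℂ) ^ (v.length + 1) else 0 := by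
    intro j v a
    rw [Matrix.mul_apply, Finset.sum_eq_single o]
    · rw [lift_conjTranspose_creation hg hsuffix, ho, mul_one]
      have h1 : g b = v.reverse ↔ v = (g b).reverse :=
        ⟨fun h => by rw [h, FreeMonoid.reverse_reverse],
          fun h => by rw [h, FreeMonoid.reverse_reverse]⟩
      by_cases h2 : j = i ∧ g a = 1 <;> by_cases h3 : v = (g b).reverse
      · simp only [vacuum, Matrix.of_apply, h2, ho, h3]
        simp [pow_succ']
      · simp [h1, h3]
      · simp only [vacuum, Matrix.of_apply]
        rw [if_neg (fun h => h2 ⟨h.1, h.2.1⟩), zero_mul, if_neg (fun h => h2 ⟨h.1, h.2.1⟩)]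
      · simp [h1, h3]
    · intro a' _ ha'
      simp only [vacuum, Matrix.of_apply]
      rw [if_neg (fun h => ha' (hg (h.2.2.trans ho.symm))), zero_mul]
    · simp
  induction w using FreeMonoid.recOn generalizing a with
  | one =>
    rw [wordDiff_one, if_neg, Matrix.zero_apply]
    intro h
    have := congrArg FreeMonoid.length h
    simp only [FreeMonoid.length_mul, FreeMonoid.length_of, FreeMonoid.length_one] at this
    omega
  | of_mul j v ih =>
    rw [wordDiff_of_mul, Matrix.add_apply, hE, Matrix.mul_apply]
    simp only [ih, creation_apply]
    -- If `g a` is empty only the splitting at the first letter survives; otherwise only later ones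
    -- do, and the first letter of `g a` is stripped.
    cases hga : g a using FreeMonoid.casesOn with
    | one =>
      rw [Finset.sum_eq_zero, add_zero]
      · refine if_congr ?_ (by simp [add_comm]) rfl
        rw [one_mul, of_mul_eq_of_mul_iff]
        simp
      · intro e _
        rw [if_neg, zero_mul]
        intro h
        have := congrArg FreeMonoid.length h
        simp only [FreeMonoid.length_mul, FreeMonoid.length_of, FreeMonoid.length_one] at this
        omega
    | of_mul k β =>
      rw [if_neg, zero_add]
      · obtain ⟨e, he⟩ := hsuffix (FreeMonoid.of k) β ⟨a, hga⟩
        rw [mul_assoc, of_mul_eq_of_mul_iff, Finset.sum_eq_single e]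
        · rw [he, of_mul_eq_of_mul_iff]
          by_cases hk : k = j
          · simp [hk, pow_add]
          · rw [if_neg (fun h => hk h.1), zero_mul, if_neg (fun h => hk h.1.symm)]
        · intro e' _ hee'
          rw [if_neg, zero_mul]
          rw [of_mul_eq_of_mul_iff]
          exact fun h => hee' (hg (h.2.symm.trans he.symm))
        · simp
      · rintro ⟨-, h, -⟩
        simpa using congrArg FreeMonoid.length h

end Fock

/-! ### Positivity of the localizing matrices -/

section Localizing

variable {d : ℕ} {K : Type*} [NormedAddCommGroup K] [InnerProductSpace ℂ K] [CompleteSpace K]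
  {c : Word d → (K →L[ℂ] K)} {f : ∀ n, Tuple d n → (Amp n K →L[ℂ] Amp n K)}

/-- For every `N` the localizing matrix, truncated to words of length at most `N` and suitably
scaled, is a positive operator. -/
lemma exists_isPositive_truncation {ε : ℝ} (hε : 0 < ε)
    (hmono : MatrixMonotoneOn (realBall d (1 + ε)) f)
    (hseries : HasPowerSeriesOnComplexBall c f (1 + ε)) (i : Fin d) (N : ℕ) :
    ∃ (n : ℕ) (g : Fin n → Word d) (r : ℝ) (T : Amp n K →L[ℂ] Amp n K),
      Function.Injective g ∧ (∀ w, w ∈ Set.range g ↔ w.length ≤ N) ∧ 0 < r ∧ T.IsPositive ∧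
      ∀ x a, T x a = ∑ b, ((r : ℂ) ^ ((g a).length + (g b).length + 1)) •
        c (g a * (FreeMonoid.of i * (g b).reverse)) (x b) := by
  obtain ⟨n, g, hg, hrange⟩ := exists_enum_words d N
  have hsuffix : ∀ u v, u * v ∈ Set.range g → v ∈ Set.range g := by
    intro u v h
    rw [hrange, FreeMonoid.length_mul] at h
    rw [hrange]
    omega
  obtain ⟨o, ho⟩ : (1 : Word d) ∈ Set.range g := (hrange 1).mpr (by simp)
  have : Nonempty (Fin n) := ⟨o⟩
  -- The size of r is immaterial beyond the 1/8 bounds: its powers are removed later.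
  obtain ⟨r, hr, hr1, hr2⟩ : ∃ r : ℝ, 0 < r ∧ (∀ j, ‖creation r g j‖ ≤ 1 / 8) ∧
      ∀ j, ‖vacuum r g i j‖ ≤ 1 / 8 := by
    have h1 : 0 < 1 + ‖creation 1 g‖ + ‖vacuum 1 g i‖ := by positivity
    have key : ∀ M : Matrix (Fin n) (Fin n) ℂ, ‖M‖ ≤ 1 + ‖creation 1 g‖ + ‖vacuum 1 g i‖ →
        ‖((1 / (8 * (1 + ‖creation 1 g‖ + ‖vacuum 1 g i‖)) : ℝ) : ℂ) • M‖ ≤ 1 / 8 := by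
      intro M hM
      rw [norm_smul, Complex.norm_real, Real.norm_of_nonneg (by positivity), div_mul_eq_mul_div,
        one_mul, div_le_div_iff₀ (by positivity) (by norm_num)]
      linarith
    refine ⟨1 / (8 * (1 + ‖creation 1 g‖ + ‖vacuum 1 g i‖)), by positivity, fun j => ?_,
      fun j => ?_⟩
    · rw [creation_smul]
      refine key _ ?_
      linarith [norm_le_pi_norm (creation 1 g) j, norm_nonneg (vacuum 1 g i)]
    · rw [vacuum_smul]
      refine key _ ?_
      linarith [norm_le_pi_norm (vacuum 1 g i) j, norm_nonneg (creation 1 g)]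
  obtain ⟨hsum, hpos⟩ := isPositive_tsum_wordDiff hε hmono hseries (fun a => (g a).length)
    (creation r g) (vacuum r g i) (fun j a b h => by
      simp only [creation, Matrix.of_apply, ne_eq, ite_eq_right_iff, not_forall] at h
      rw [h.1, FreeMonoid.length_mul, FreeMonoid.length_of, add_comm])
    (fun j a b h => by
      simp only [vacuum, Matrix.of_apply, ne_eq, ite_eq_right_iff, not_forall] at h
      simp [h.1.2.1, h.1.2.2])
    (posSemidef_vacuum hr.le g i) hr1 hr2
  refine ⟨n, g, r, _, hg, hrange, hr, hpos, fun x a => ?_⟩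
  have h1 := hsum.hasSum.mapL
    ((PiLp.proj 2 (𝕜 := ℂ) (fun _ : Fin n => K) a) ∘L ContinuousLinearMap.apply ℂ _ x)
  simp only [ContinuousLinearMap.comp_apply, ContinuousLinearMap.apply_apply, PiLp.proj_apply,
    tensor_apply] at h1
  refine h1.unique (hasSum_sum fun b _ => ?_)
  have h2 := hasSum_single (f := fun w => wordDiff (creation r g) (vacuum r g i)
    (fun j => (creation r g j).conjTranspose) w a b • c w (x b))
    (g a * (FreeMonoid.of i * (g b).reverse)) (fun w hw => by
      rw [wordDiff_creation hg hsuffix, if_neg hw, zero_smul])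
  rw [wordDiff_creation hg hsuffix, if_pos rfl] at h2
  convert h2 using 3
  simp only [FreeMonoid.length_mul, FreeMonoid.length_of, FreeMonoid.length_reverse]
  ring

/-- Each test involves finitely many words, so a long enough truncation decides it. The truncation
has entries c_{a x_i b*}, hence the reversal of the enumerated words. -/
lemma posSemidef_localizingMatrix {ε : ℝ} (hε : 0 < ε)
    (hmono : MatrixMonotoneOn (realBall d (1 + ε)) f)
    (hseries : HasPowerSeriesOnComplexBall c f (1 + ε)) (i : Fin d) :
    (localizingMatrix c i).PosSemidef := by
  refine ⟨?_, fun x => ?_⟩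
  · ext β α : 1
    obtain ⟨n, g, r, T, hg, hrange, hr, hT, hTx⟩ :=
      exists_isPositive_truncation hε hmono hseries i (max α.length β.length)
    obtain ⟨a, ha⟩ := (hrange α.reverse).mpr (by simp)
    obtain ⟨b, hb⟩ := (hrange β.reverse).mpr (by simp)
    rw [Matrix.conjTranspose_apply, ContinuousLinearMap.star_eq_adjoint]
    symm
    rw [ContinuousLinearMap.eq_adjoint_iff]
    intro v w
    have h := hT.isSymmetric (WithLp.toLp 2 (Pi.single a v)) (WithLp.toLp 2 (Pi.single b w))
    have hs : ∀ (a b : Fin n) (v : K), T (WithLp.toLp 2 (Pi.single a v)) b =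
        ((r : ℂ) ^ ((g b).length + (g a).length + 1)) •
          c (g b * (FreeMonoid.of i * (g a).reverse)) v := by
      intro a b v
      rw [hTx, Finset.sum_eq_single a]
      · simp
      · intro e _ he
        simp [he]
      · simp
    simp only [PiLp.inner_apply, ContinuousLinearMap.coe_coe] at h
    rw [Finset.sum_eq_single b (fun e _ he => by simp [he]) (by simp),
      Finset.sum_eq_single a (fun e _ he => by simp [he]) (by simp), hs, hs] at h
    simp only [Pi.single_eq_same, inner_smul_left, inner_smul_right, map_pow,
      Complex.conj_ofReal, add_comm (g b).length] at h
    have h' := mul_left_cancel₀ (pow_ne_zero _ (by exact_mod_cast hr.ne')) h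
    rw [ha, hb, FreeMonoid.reverse_reverse, FreeMonoid.reverse_reverse] at h'
    simpa only [localizingMatrix, Matrix.of_apply, mul_assoc] using h'
  · classical
    rw [ContinuousLinearMap.nonneg_iff_isPositive, ContinuousLinearMap.isPositive_iff_complex]
    intro v
    obtain ⟨n, g, r, T, hg, hrange, hr, hT, hTx⟩ :=
      exists_isPositive_truncation hε hmono hseries i (x.support.sup FreeMonoid.length)
    have hinj : Function.Injective fun a => (g a).reverse := fun a b hab => hg <| by
      simpa only [FreeMonoid.reverse_reverse] using congrArg FreeMonoid.reverse hab
    have hrC : (r : ℂ) ≠ 0 := by exact_mod_cast hr.ne'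
    have hsum : ∀ F : Word d → (K →L[ℂ] K) → (K →L[ℂ] K), (∀ α, F α 0 = 0) →
        x.sum F = ∑ a, F (g a).reverse (x (g a).reverse) := by
      intro F hF
      rw [← Finset.sum_image (s := Finset.univ) (g := fun a => (g a).reverse)
        (f := fun α => F α (x α)) hinj.injOn]
      refine Finsupp.sum_of_support_subset _ (fun α hα => ?_) _ fun α _ => hF α
      obtain ⟨a, ha⟩ := (hrange α.reverse).mpr (by
        rw [FreeMonoid.length_reverse]
        exact Finset.le_sup (f := FreeMonoid.length) hα)
      exact Finset.mem_image.mpr ⟨a, Finset.mem_univ _, by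
        rw [ha, FreeMonoid.reverse_reverse]⟩
    -- The weights cancel r^{|a| + |b|}, leaving a single positive factor r.
    let V : Amp n K := WithLp.toLp 2 fun a => ((r : ℂ) ^ (g a).length)⁻¹ • x (g a).reverse v
    have hV : ∀ a, V a = ((r : ℂ) ^ (g a).length)⁻¹ • x (g a).reverse v := fun a => rfl
    have key : inner ℂ (T V) V = r * inner ℂ ((x.sum fun i_1 xi => x.sum fun j xj =>
        star xi * localizingMatrix c i i_1 j * xj) v) v := by
      rw [hsum _ (fun α => by simp)]
      simp only [fun β xi => hsum (fun j xj => star xi * localizingMatrix c i β j * xj)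
        (fun α => by simp)]
      simp only [sum_apply, sum_inner, PiLp.inner_apply, hTx, Finset.mul_sum]
      refine Finset.sum_congr rfl fun a _ => Finset.sum_congr rfl fun b _ => ?_
      simp only [mul_apply_eq_comp, ContinuousLinearMap.star_eq_adjoint,
        ContinuousLinearMap.adjoint_inner_left, hV, map_smul, inner_smul_left, inner_smul_right,
        map_inv₀, map_pow, Complex.conj_ofReal, localizingMatrix, Matrix.of_apply,
        FreeMonoid.reverse_reverse, mul_assoc (g a)]
      field_simp
      ring
    have hpos : 0 ≤ inner ℂ ((x.sum fun i_1 xi => x.sum fun j xj =>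
        star xi * localizingMatrix c i i_1 j * xj) v) v := by
      have h := hT.inner_nonneg_left V
      rw [key] at h
      have h' := mul_nonneg (Complex.zero_le_real.mpr (inv_pos.mpr hr).le) h
      rwa [← mul_assoc, ← Complex.ofReal_mul, inv_mul_cancel₀ hr.ne', Complex.ofReal_one,
        one_mul] at h'
    obtain ⟨h1, h2⟩ := RCLike.nonneg_iff.mp hpos
    exact ⟨RCLike.ext (by simp) (by simpa using h2.symm), h1⟩

end Localizing

/-! ### Log-convex sequences and words of fixed length -/

section Growth

/-- Log-convexity makes the ratios nondecreasing, so u k ≥ q^k u 0 with q = u 1 / u 0; q > ρ would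
beat C ρ^k. -/
lemma le_mul_of_sq_le_of_growth {u : ℕ → ℝ} (hu : ∀ k, 0 ≤ u k)
    (hconv : ∀ k, u (k + 1) ^ 2 ≤ u k * u (k + 2)) {C ρ : ℝ} (hρ : 0 < ρ)
    (hgrowth : ∀ k, u k ≤ C * ρ ^ k) : u 1 ≤ ρ * u 0 := by
  by_contra! hlt
  have h0 : 0 < u 0 := by
    refine (hu 0).lt_of_ne fun h => ?_
    have h1 := hconv 0
    simp only [← h, zero_mul, zero_add, mul_zero] at h1 hlt
    nlinarith
  set q := u 1 / u 0 with hq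
  have hqρ : ρ < q := by rwa [hq, lt_div_iff₀ h0]
  have hq0 : 0 < q := hρ.trans hqρ
  have hstep : ∀ k, 0 < u k ∧ q * u k ≤ u (k + 1) := by
    intro k
    induction k with
    | zero => exact ⟨h0, by rw [hq, div_mul_cancel₀ _ h0.ne']⟩
    | succ k ih =>
      have hpos : 0 < u (k + 1) := (mul_pos hq0 ih.1).trans_le ih.2
      refine ⟨hpos, ?_⟩
      have h1 := hconv k
      have h2 : q * u k * u (k + 1) ≤ u (k + 1) * u (k + 1) :=
        mul_le_mul_of_nonneg_right ih.2 hpos.le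
      have h3 : u k * (q * u (k + 1)) ≤ u k * u (k + 2) := by nlinarith
      exact le_of_mul_le_mul_left h3 ih.1
  have hpow : ∀ k, q ^ k * u 0 ≤ u k := by
    intro k
    induction k with
    | zero => simp
    | succ k ih =>
      calc q ^ (k + 1) * u 0 = q * (q ^ k * u 0) := by ring
        _ ≤ q * u k := mul_le_mul_of_nonneg_left ih hq0.le
        _ ≤ u (k + 1) := (hstep k).2
  have hone : 1 < q / ρ := (one_lt_div hρ).mpr hqρ
  obtain ⟨k, hk⟩ := pow_unbounded_of_one_lt (C / u 0) hone
  rw [div_pow, div_lt_div_iff₀ h0 (by positivity)] at hk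
  linarith [hpow k, hgrowth k]

variable {d : ℕ} {K : Type*} [NormedAddCommGroup K] [InnerProductSpace ℂ K]
  {c : Word d → (K →L[ℂ] K)}

lemma sum_ofFn_succ {M : Type*} [AddCommMonoid M] (F : Word d → M) (m : ℕ) :
    ∑ w : Fin (m + 1) → Fin d, F (FreeMonoid.ofList (List.ofFn w)) =
      ∑ i, ∑ w : Fin m → Fin d, F (FreeMonoid.of i * FreeMonoid.ofList (List.ofFn w)) := by
  rw [← (Fin.consEquiv fun _ => Fin d).sum_comp, Fintype.sum_prod_type]
  refine Finset.sum_congr rfl fun i _ => Finset.sum_congr rfl fun w _ => ?_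
  congr 1
  rw [List.ofFn_succ]
  rfl

lemma sum_ofFn_succ_last {M : Type*} [AddCommMonoid M] (F : Word d → M) (m : ℕ) :
    ∑ w : Fin (m + 1) → Fin d, F (FreeMonoid.ofList (List.ofFn w)) =
      ∑ i, ∑ w : Fin m → Fin d, F (FreeMonoid.ofList (List.ofFn w) * FreeMonoid.of i) := by
  rw [← (Fin.snocEquiv fun _ => Fin d).sum_comp, Fintype.sum_prod_type]
  refine Finset.sum_congr rfl fun i _ => Finset.sum_congr rfl fun w _ => ?_
  congr 1
  rw [List.ofFn_succ', Fin.snocEquiv_apply]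
  simp [FreeMonoid.ofList_append]

/-- The words γwμ are distinct and of equal length, so they form a subfamily of the weighted sum
with one common weight. The constant is independent of γ, μ and m. -/
lemma exists_sum_norm_coeff_le {r : ℝ} (hr : 0 < r)
    (hc : Summable fun α => ‖c α‖ * r ^ α.length) :
    ∃ C, 0 ≤ C ∧ ∀ (γ μ : Word d) (m : ℕ),
      ∑ w : Fin m → Fin d, ‖c (γ * FreeMonoid.ofList (List.ofFn w) * μ)‖ ≤
        C * r⁻¹ ^ (γ.length + m + μ.length) := by
  refine ⟨∑' α, ‖c α‖ * r ^ α.length, tsum_nonneg fun α => by positivity, fun γ μ m => ?_⟩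
  have hinj : Function.Injective fun w : Fin m → Fin d =>
      γ * FreeMonoid.ofList (List.ofFn w) * μ := by
    intro w w' h
    exact List.ofFn_injective (FreeMonoid.ofList.injective (mul_left_cancel (mul_right_cancel h)))
  have h1 := hc.sum_le_tsum (Finset.univ.map ⟨_, hinj⟩) fun α _ => by positivity
  rw [Finset.sum_map] at h1
  simp only [Function.Embedding.coeFn_mk, FreeMonoid.length_mul, length_ofList_ofFn] at h1
  rw [← Finset.sum_mul] at h1
  rwa [inv_pow, ← div_eq_mul_inv, le_div_iff₀ (by positivity)]

/-- Finite linear combinations of the symbols `P_j (α ⊗ v)`. -/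
abbrev SymbolSpace (d : ℕ) (K : Type*) [NormedAddCommGroup K] := (Fin d × Word d) →₀ K

/-- The shift on formal combinations of symbols. -/
def symbolShift (d : ℕ) (K : Type*) [NormedAddCommGroup K] [InnerProductSpace ℂ K] :
    SymbolSpace d K →ₗ[ℂ] SymbolSpace d K :=
  Finsupp.lsum ℂ fun p => ∑ i, Finsupp.lsingle (i, FreeMonoid.of p.1 * p.2)

lemma symbolShift_single (j : Fin d) (α : Word d) (v : K) :
    symbolShift d K (Finsupp.single (j, α) v) =
      ∑ i, Finsupp.single (i, FreeMonoid.of j * α) v := by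
  simp [symbolShift]

end Growth

/-! ### The shift operator: existence, symmetry, norm -/

section Shift

variable {d : ℕ} {K : Type*} [NormedAddCommGroup K] [InnerProductSpace ℂ K] [CompleteSpace K]
  (c : Word d → (K →L[ℂ] K)) [∀ i, Fact (localizingMatrix c i).PosSemidef]

lemma P_mul_P (i j : Fin d) : P c i * P c j = if i = j then P c i else 0 := by
  ext x k
  rw [mul_apply_eq_comp, P_apply, P_apply]
  split_ifs with h1 h2 h3 h3 <;> simp_all [P_apply]

lemma sum_P : ∑ i, P c i = 1 := by
  ext x k
  simp [P_apply]

lemma inner_P_left (i : Fin d) (x y : H c) : inner ℂ (P c i x) y = inner ℂ (x i) (y i) := by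
  rw [PiLp.inner_apply, Finset.sum_eq_single i]
  · simp [P_apply]
  · intro j _ hj
    simp [P_apply, hj]
  · simp

lemma star_P (i : Fin d) : star (P c i) = P c i := by
  symm
  rw [ContinuousLinearMap.star_eq_adjoint, ContinuousLinearMap.eq_adjoint_iff]
  intro x y
  rw [inner_P_left, ← inner_conj_symm x, inner_P_left, inner_conj_symm]

lemma inner_P_sym (j : Fin d) (α β : Word d) (v w : K) :
    inner ℂ (P c j (sym c β w)) (sym c α v) =
      inner ℂ w (c (β.reverse * FreeMonoid.of j * α) v) := by
  rw [inner_P_left, sym_apply, sym_apply, inner_symi]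

lemma inner_P_sym_P_sym (j k : Fin d) (α β : Word d) (v w : K) :
    inner ℂ (P c j (sym c β w)) (P c k (sym c α v)) =
      if j = k then inner ℂ w (c (β.reverse * FreeMonoid.of j * α) v) else 0 := by
  rw [inner_P_left, P_apply]
  split_ifs with h
  · rw [sym_apply, sym_apply, inner_symi]
  · simp

/-- The map from formal combinations of symbols to the Hilbert space `H`. -/
def symbolMap : SymbolSpace d K →ₗ[ℂ] H c :=
  Finsupp.lsum ℂ fun p => (P c p.1 ∘L sym c p.2).toLinearMap

lemma symbolMap_single (j : Fin d) (α : Word d) (v : K) :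
    symbolMap c (Finsupp.single (j, α) v) = P c j (sym c α v) := by
  simp [symbolMap]

lemma symbolMap_symbolShift_single (j : Fin d) (α : Word d) (v : K) :
    symbolMap c (symbolShift d K (Finsupp.single (j, α) v)) = sym c (FreeMonoid.of j * α) v := by
  rw [symbolShift_single, map_sum]
  simp only [symbolMap_single]
  rw [← sum_apply, sum_P, one_apply_eq_self]

lemma isShift_iff (A : H c →L[ℂ] H c) :
    IsShift c A ↔ ∀ x, A (symbolMap c x) = symbolMap c (symbolShift d K x) := by
  constructor
  · intro h x
    induction x using Finsupp.induction_linear with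
    | zero => simp
    | add x y hx hy => simp only [map_add, hx, hy]
    | single p v => rw [symbolMap_single, symbolMap_symbolShift_single, h]
  · intro h j α v
    rw [← symbolMap_symbolShift_single, ← h, symbolMap_single]

lemma denseRange_symbolMap : DenseRange (symbolMap c) := by
  have h : (LinearMap.range (symbolMap c)).topologicalClosure = ⊤ := by
    rw [Submodule.topologicalClosure_eq_top_iff, Submodule.eq_bot_iff]
    intro x hx
    ext1 j
    have hj : x j ∈ (Submodule.span ℂ {y | ∃ α v, symi c j α v = y})ᗮ := by
      rw [Submodule.mem_orthogonal]
      intro u hu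
      induction hu using Submodule.span_induction with
      | mem u hu =>
        obtain ⟨α, v, rfl⟩ := hu
        have h1 := (Submodule.mem_orthogonal _ _).mp hx _
          ⟨Finsupp.single (j, α) v, rfl⟩
        rwa [symbolMap_single, inner_P_left, sym_apply] at h1
      | zero => simp
      | add u w _ _ hu hw => rw [inner_add_left, hu, hw, add_zero]
      | smul a u _ hu => rw [inner_smul_left, hu, mul_zero]
    rw [Submodule.topologicalClosure_eq_top_iff.mp (dense_span_symi c j)] at hj
    exact hj
  have h2 := Submodule.dense_iff_topologicalClosure_eq_top.mpr h
  exact h2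

/-- On symbols both sides equal ⟨w, c_{β* x_j x_k α} v⟩: the localizing matrices have a Hankel
structure. -/
lemma inner_symbolShift (x y : SymbolSpace d K) :
    inner ℂ (symbolMap c (symbolShift d K x)) (symbolMap c y) =
      inner ℂ (symbolMap c x) (symbolMap c (symbolShift d K y)) := by
  induction x using Finsupp.induction_linear with
  | zero => simp
  | add x x' hx hx' => simp only [map_add, inner_add_left, hx, hx']
  | single p w =>
    induction y using Finsupp.induction_linear with
    | zero => simp
    | add y y' hy hy' => simp only [map_add, inner_add_right, hy, hy']
    | single q v =>
      obtain ⟨j, β⟩ := p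
      obtain ⟨k, α⟩ := q
      rw [symbolMap_symbolShift_single, symbolMap_symbolShift_single, symbolMap_single,
        symbolMap_single, inner_P_sym, ← inner_conj_symm, inner_P_left, inner_conj_symm,
        sym_apply, sym_apply, inner_symi, FreeMonoid.reverse_mul, FreeMonoid.reverse_of]
      simp only [mul_assoc]

/-- For m ≥ 1 only words u starting with x_j really occur; summing over all u keeps the induction
uniform. -/
lemma norm_inner_symbolShift_pow_single_le (j k : Fin d) (α β : Word d) (v w : K) (m : ℕ) :
    ‖inner ℂ (symbolMap c (Finsupp.single (j, β) w))
      (symbolMap c ((symbolShift d K ^ m) (Finsupp.single (k, α) v)))‖ ≤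
      ‖w‖ * ‖v‖ * ∑ u : Fin m → Fin d,
        ‖c (β.reverse * FreeMonoid.ofList (List.ofFn u) * (FreeMonoid.of k * α))‖ := by
  induction m generalizing k α with
  | zero =>
    rw [pow_zero, Module.End.one_apply, symbolMap_single, symbolMap_single, inner_P_sym_P_sym]
    split_ifs with h
    · subst h
      rw [Fintype.sum_unique, List.ofFn_zero, FreeMonoid.ofList_nil, mul_one, ← mul_assoc]
      refine (norm_inner_le_norm _ _).trans ?_
      rw [mul_assoc ‖w‖]
      refine mul_le_mul_of_nonneg_left ?_ (norm_nonneg w)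
      rw [mul_comm]
      exact ContinuousLinearMap.le_opNorm _ _
    · rw [norm_zero]
      positivity
  | succ m ih =>
    rw [pow_succ, Module.End.mul_apply, symbolShift_single, map_sum, map_sum, inner_sum,
      sum_ofFn_succ_last (fun μ => ‖c (β.reverse * μ * (FreeMonoid.of k * α))‖), Finset.mul_sum]
    refine (norm_sum_le _ _).trans (Finset.sum_le_sum fun i _ => (ih i _).trans_eq ?_)
    simp only [mul_assoc]

variable {c} in
lemma exists_norm_inner_symbolShift_pow_le {r : ℝ} (hr : 0 < r)
    (hc : Summable fun α => ‖c α‖ * r ^ α.length) (x y : SymbolSpace d K) :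
    ∃ C, ∀ m, ‖inner ℂ (symbolMap c x) (symbolMap c ((symbolShift d K ^ m) y))‖ ≤
      C * r⁻¹ ^ m := by
  induction x using Finsupp.induction_linear with
  | zero => exact ⟨0, by simp⟩
  | add x x' hx hx' =>
    obtain ⟨C, hC⟩ := hx
    obtain ⟨C', hC'⟩ := hx'
    refine ⟨C + C', fun m => ?_⟩
    rw [map_add, inner_add_left, add_mul]
    exact (norm_add_le _ _).trans (add_le_add (hC m) (hC' m))
  | single p w =>
    induction y using Finsupp.induction_linear with
    | zero => exact ⟨0, by simp⟩
    | add y y' hy hy' =>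
      obtain ⟨C, hC⟩ := hy
      obtain ⟨C', hC'⟩ := hy'
      refine ⟨C + C', fun m => ?_⟩
      rw [map_add, map_add, inner_add_right, add_mul]
      exact (norm_add_le _ _).trans (add_le_add (hC m) (hC' m))
    | single q v =>
      obtain ⟨j, β⟩ := p
      obtain ⟨k, α⟩ := q
      obtain ⟨C, -, hC⟩ := exists_sum_norm_coeff_le hr hc
      refine ⟨‖w‖ * ‖v‖ * (C * r⁻¹ ^ (β.reverse.length + (FreeMonoid.of k * α).length)),
        fun m => ?_⟩
      refine (norm_inner_symbolShift_pow_single_le c j k α β v w m).trans ?_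
      rw [mul_assoc (‖w‖ * ‖v‖)]
      refine mul_le_mul_of_nonneg_left ((hC _ _ m).trans_eq ?_) (by positivity)
      ring

variable {c} in
-- Cauchy–Schwarz and symmetry give log-convexity of ‖S^k x‖, and ‖S^k x‖² = |⟨x, S^{2k} x⟩| ≤ C
-- r^{-2k}. The constant depends on x but the rate does not. In particular null combinations go to
-- null combinations, so the shift descends to H.
lemma norm_symbolMap_symbolShift_le {r : ℝ} (hr : 0 < r)
    (hc : Summable fun α => ‖c α‖ * r ^ α.length) (x : SymbolSpace d K) :
    ‖symbolMap c (symbolShift d K x)‖ ≤ r⁻¹ * ‖symbolMap c x‖ := by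
  have hsymm : ∀ (m : ℕ) (y z : SymbolSpace d K),
      inner ℂ (symbolMap c ((symbolShift d K ^ m) y)) (symbolMap c z) =
        inner ℂ (symbolMap c y) (symbolMap c ((symbolShift d K ^ m) z)) := by
    intro m
    induction m with
    | zero => simp
    | succ m ih =>
      intro y z
      rw [pow_succ, Module.End.mul_apply, ih, inner_symbolShift, ← Module.End.mul_apply,
        ← pow_succ', ← pow_succ]
  have hsq : ∀ (m l p : ℕ), m + m = l + p → ‖symbolMap c ((symbolShift d K ^ m) x)‖ ^ 2 =
      ‖inner ℂ (symbolMap c ((symbolShift d K ^ l) x))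
        (symbolMap c ((symbolShift d K ^ p) x))‖ := by
    intro m l p h
    rw [hsymm, ← Module.End.mul_apply, ← pow_add, ← h, pow_add, Module.End.mul_apply, ← hsymm,
      inner_self_eq_norm_sq_to_K, norm_pow, RCLike.norm_ofReal, abs_norm]
  obtain ⟨C, hC⟩ := exists_norm_inner_symbolShift_pow_le hr hc x x
  have hrinv : 0 < r⁻¹ := inv_pos.mpr hr
  have h := le_mul_of_sq_le_of_growth
    (u := fun k => ‖symbolMap c ((symbolShift d K ^ k) x)‖) (fun k => norm_nonneg _)
    (fun k => by
      rw [hsq (k + 1) k (k + 2) (by ring)]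
      exact norm_inner_le_norm _ _) hrinv (C := √C) (fun k => by
      have hk := hC (k + k)
      have h0 := hsq k 0 (k + k) (by ring)
      rw [pow_zero, Module.End.one_apply] at h0
      rw [← h0, pow_add, ← sq] at hk
      have hC0 : 0 ≤ C := by
        have := (norm_nonneg _).trans (hC 0)
        simpa using this
      refine (pow_le_pow_iff_left₀ (norm_nonneg _) (by positivity) two_ne_zero).mp ?_
      rw [mul_pow, Real.sq_sqrt hC0]
      exact hk)
  simpa using h

lemma exists_isShift {r : ℝ} (hr : 0 < r) (hc : Summable fun α => ‖c α‖ * r ^ α.length) :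
    ∃ A : H c →L[ℂ] H c, IsShift c A := by
  refine ⟨(symbolMap c ∘ₗ symbolShift d K).extendOfNorm (symbolMap c), ?_⟩
  rw [isShift_iff]
  intro x
  exact LinearMap.extendOfNorm_eq (denseRange_symbolMap c)
    ⟨r⁻¹, norm_symbolMap_symbolShift_le hr hc⟩ x

variable {c} {A : H c →L[ℂ] H c}

lemma IsShift.unique {A' : H c →L[ℂ] H c} (hA : IsShift c A) (hA' : IsShift c A') : A = A' := by
  rw [isShift_iff] at hA hA'
  refine DFunLike.coe_injective ((denseRange_symbolMap c).equalizer A.continuous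
    A'.continuous (funext fun x => ?_))
  exact (hA x).trans (hA' x).symm

lemma IsShift.isSelfAdjoint (hA : IsShift c A) : IsSelfAdjoint A := by
  rw [isShift_iff] at hA
  rw [ContinuousLinearMap.isSelfAdjoint_iff_isSymmetric]
  intro x y
  refine (denseRange_symbolMap c).induction_on₂ (p := fun x y => inner ℂ (A x) y = inner ℂ x (A y))
    (isClosed_eq (by fun_prop) (by fun_prop)) (fun x y => ?_) x y
  rw [hA, hA, inner_symbolShift]

lemma IsShift.norm_le (hA : IsShift c A) {r : ℝ} (hr : 0 < r)
    (hc : Summable fun α => ‖c α‖ * r ^ α.length) : ‖A‖ ≤ r⁻¹ := by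
  rw [isShift_iff] at hA
  refine ContinuousLinearMap.opNorm_le_bound _ (by positivity) fun x => ?_
  refine (denseRange_symbolMap c).induction_on (p := fun x => ‖A x‖ ≤ r⁻¹ * ‖x‖) x
    (isClosed_le (by fun_prop) (by fun_prop)) fun x => ?_
  rw [hA]
  exact norm_symbolMap_symbolShift_le hr hc x

lemma IsShift.apply_sym (hA : IsShift c A) (α : Word d) (v : K) :
    A (sym c α v) = ∑ i, sym c (FreeMonoid.of i * α) v := by
  conv_lhs => rw [← one_apply_eq_self (F := H c →L[ℂ] H c) (sym c α v), ← sum_P c, sum_apply, map_sum]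
  exact Finset.sum_congr rfl fun i _ => hA i α v

end Shift

/-! ### Neumann series and the realization formula -/

/-- Neumann series for `p = -(1 - S) D⁻¹`. -/
lemma isUnit_and_hasSum_neg_inverse {B : Type*} [NormedRing B] [CompleteSpace B]
    {S D D' p : B} (hS : ‖S‖ < 1) (h1 : D * D' = 1) (h2 : D' * D = 1)
    (hp : p = -((1 - S) * D')) :
    IsUnit p ∧ HasSum (fun k : ℕ => D * S ^ k) (-Ring.inverse p) := by
  have hG1 : (1 - S) * ∑' k, S ^ k = 1 := mul_neg_geom_series S hS
  have hG2 : (∑' k, S ^ k) * (1 - S) = 1 := geom_series_mul_neg S hS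
  have hinv1 : p * -(D * ∑' k, S ^ k) = 1 := by
    rw [hp, neg_mul_neg, mul_assoc, ← mul_assoc D', h2, one_mul, hG1]
  have hinv2 : -(D * ∑' k, S ^ k) * p = 1 := by
    rw [hp, neg_mul_neg, mul_assoc, ← mul_assoc (∑' k, S ^ k), hG2, one_mul, h1]
  have hri : Ring.inverse p = -(D * ∑' k, S ^ k) :=
    Ring.inverse_unit (⟨p, -(D * ∑' k, S ^ k), hinv1, hinv2⟩ : Bˣ)
  refine ⟨⟨⟨p, _, hinv1, hinv2⟩, rfl⟩, ?_⟩
  rw [hri, neg_neg]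
  exact (summable_geometric_of_norm_lt_one hS).hasSum.mul_left D

lemma hasSum_comp_comp {E F : Type*} [NormedAddCommGroup E] [NormedSpace ℂ E]
    [NormedAddCommGroup F] [NormedSpace ℂ F] {T : ℕ → (F →L[ℂ] F)} {t : F →L[ℂ] F}
    (hT : HasSum T t) (U : F →L[ℂ] E) (V : E →L[ℂ] F) :
    HasSum (fun k => U ∘L T k ∘L V) (U ∘L t ∘L V) :=
  hT.mapL ((ContinuousLinearMap.compL ℂ E F E U) ∘L ((ContinuousLinearMap.compL ℂ E F F).flip V))

section Realization

variable {d n : ℕ} {K : Type*} [NormedAddCommGroup K] [InnerProductSpace ℂ K] [CompleteSpace K]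
  {c : Word d → (K →L[ℂ] K)} [∀ i, Fact (localizingMatrix c i).PosSemidef]
  {A : H c →L[ℂ] H c}

variable (c) in
/-- The block diagonal operator `∑ P_i ⊗ Z_i` on `H ⊗ ℂⁿ`. -/
def blockDiag (Z : Tuple d n) : Amp n (H c) →L[ℂ] Amp n (H c) := ∑ i, tensor (P c i) (Z i)

lemma norm_blockDiag_le (Z : Tuple d n) : ‖blockDiag c Z‖ ≤ ‖Z‖ :=
  norm_sum_tensor_proj_le _ (P_mul_P c) (star_P c) Z

lemma blockDiag_mul (Z W : Tuple d n) : blockDiag c (Z * W) = blockDiag c Z * blockDiag c W :=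
  map_mul (tensorProjHom n (P c) (P_mul_P c) (star_P c)) Z W

lemma blockDiag_one : blockDiag c (1 : Tuple d n) = 1 := by
  simp only [blockDiag, Pi.one_apply]
  rw [← tensor_sum_left, sum_P, tensor_one_one]

lemma blockDiag_comp_tensor (Z : Tuple d n) {E : Type*} [NormedAddCommGroup E]
    [InnerProductSpace ℂ E] (T : E →L[ℂ] H c) (M : Matrix (Fin n) (Fin n) ℂ) :
    blockDiag c Z ∘L tensor T M = ∑ i, tensor (P c i ∘L T) (Z i * M) := by
  simp only [tensor_comp, blockDiag]
  ext1 x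
  simp

lemma adjoint_Q_comp_P_comp_sym (i : Fin d) (α : Word d) :
    (Q c).adjoint ∘L P c i ∘L sym c α = c (FreeMonoid.of i * α) := by
  ext v
  refine ext_inner_left ℂ fun w => ?_
  rw [ContinuousLinearMap.comp_apply, ContinuousLinearMap.adjoint_inner_right,
    ContinuousLinearMap.comp_apply, ← inner_conj_symm, inner_P_left, inner_conj_symm, Q,
    sym_apply, sym_apply, inner_symi]
  rfl

/-- Each factor prepends a letter x_i to the symbol and the same Z_i to the matrix product. -/
lemma IsShift.pow_comp_tensor_Q (hA : IsShift c A) (Z : Tuple d n) (k : ℕ) :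
    ((tensor A 1 * blockDiag c Z) ^ k) ∘L tensor (Q c) 1 =
      ∑ w : Fin k → Fin d, tensor (sym c (FreeMonoid.ofList (List.ofFn w)))
        (FreeMonoid.lift Z (FreeMonoid.ofList (List.ofFn w))) := by
  induction k with
  | zero =>
    rw [pow_zero, Fintype.sum_unique, List.ofFn_zero, FreeMonoid.ofList_nil, map_one]
    rfl
  | succ k ih =>
    have hAP : ∀ i α, A ∘L (P c i ∘L sym c α) = sym c (FreeMonoid.of i * α) := fun i α => by
      ext1 v
      exact hA i α v
    have hstep : ∀ α : Word d, tensor A 1 ∘L (blockDiag c Z ∘L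
        tensor (sym c α) (FreeMonoid.lift Z α)) = ∑ i, tensor (sym c (FreeMonoid.of i * α))
          (FreeMonoid.lift Z (FreeMonoid.of i * α)) := by
      intro α
      rw [blockDiag_comp_tensor, ContinuousLinearMap.comp_finsetSum]
      refine Finset.sum_congr rfl fun i _ => ?_
      rw [← tensor_comp, hAP, one_mul, map_mul, FreeMonoid.lift_eval_of]
    have hcomp : ((tensor A 1 * blockDiag c Z) ^ (k + 1)) ∘L tensor (Q c) 1 =
        tensor A 1 ∘L (blockDiag c Z ∘L (((tensor A 1 * blockDiag c Z) ^ k) ∘L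
          tensor (Q c) 1)) := by
      rw [pow_succ']
      rfl
    rw [hcomp, ih, ContinuousLinearMap.comp_finsetSum, ContinuousLinearMap.comp_finsetSum,
      sum_ofFn_succ fun α => tensor (sym c α) (FreeMonoid.lift Z α), Finset.sum_comm]
    exact Finset.sum_congr rfl fun w _ => hstep _

/-- The outer block diagonal supplies one more letter, since Q* P_i (α ⊗ v) = c_{x_i α} v; hence
degree k + 1. -/
lemma IsShift.adjoint_Q_comp_pow (hA : IsShift c A) (Z : Tuple d n) (k : ℕ) :
    (tensor (Q c) 1).adjoint ∘L (blockDiag c Z * (tensor A 1 * blockDiag c Z) ^ k) ∘L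
      tensor (Q c) 1 = ∑ w : Fin (k + 1) → Fin d,
        seriesTerm c Z (FreeMonoid.ofList (List.ofFn w)) := by
  have hcomp : (tensor (Q c) 1).adjoint ∘L
      (blockDiag c Z * (tensor A 1 * blockDiag c Z) ^ k) ∘L tensor (Q c) 1 =
      (tensor (Q c) 1).adjoint ∘L (blockDiag c Z ∘L
        (((tensor A 1 * blockDiag c Z) ^ k) ∘L tensor (Q c) 1)) := rfl
  rw [hcomp, hA.pow_comp_tensor_Q, ContinuousLinearMap.comp_finsetSum,
    ContinuousLinearMap.comp_finsetSum, sum_ofFn_succ, Finset.sum_comm]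
  refine Finset.sum_congr rfl fun w _ => ?_
  rw [blockDiag_comp_tensor, ContinuousLinearMap.comp_finsetSum]
  refine Finset.sum_congr rfl fun i _ => ?_
  rw [adjoint_tensor, Matrix.conjTranspose_one, ← tensor_comp, adjoint_Q_comp_P_comp_sym, one_mul,
    seriesTerm, map_mul, FreeMonoid.lift_eval_of]

lemma pencil_eq (A : H c →L[ℂ] H c) {Z : Tuple d n} (hZ : ∀ i, IsUnit (Z i)) :
    pencil c A Z = -((1 - tensor A 1 * blockDiag c Z) * blockDiag c (fun i => (Z i)⁻¹)) ∧
      blockDiag c Z * blockDiag c (fun i => (Z i)⁻¹) = 1 ∧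
      blockDiag c (fun i => (Z i)⁻¹) * blockDiag c Z = 1 := by
  have h1 : blockDiag c Z * blockDiag c (fun i => (Z i)⁻¹) = 1 := by
    rw [← blockDiag_mul, ← blockDiag_one]
    congr 1
    ext1 i
    exact Matrix.mul_nonsing_inv _ ((Matrix.isUnit_iff_isUnit_det _).mp (hZ i))
  have h2 : blockDiag c (fun i => (Z i)⁻¹) * blockDiag c Z = 1 := by
    rw [← blockDiag_mul, ← blockDiag_one]
    congr 1
    ext1 i
    exact Matrix.nonsing_inv_mul _ ((Matrix.isUnit_iff_isUnit_det _).mp (hZ i))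
  refine ⟨?_, h1, h2⟩
  rw [sub_mul, one_mul, mul_assoc, h1, mul_one, neg_sub]
  rfl

lemma IsShift.realization {f : ∀ n, Tuple d n → (Amp n K →L[ℂ] Amp n K)} {R : ℝ}
    (hR : 0 < R) (hA : IsShift c A) (hseries : HasPowerSeriesOnComplexBall c f R) {Z : Tuple d n}
    (hZ : Z ∈ complexBall d R n) (hZu : ∀ i, IsUnit (Z i)) :
    IsUnit (pencil c A Z) ∧
      f n Z = tensor (c 1) 1 - (tensor (Q c) 1).adjoint ∘L
        Ring.inverse (pencil c A Z) ∘L tensor (Q c) 1 := by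
  obtain ⟨hp, h1, h2⟩ := pencil_eq A hZu
  set D := blockDiag c Z
  set S := tensor A 1 * D
  have hZn : ‖Z‖ < R := (pi_norm_lt_iff hR).mpr hZ
  -- As ‖Z‖ may exceed 1, the bound ‖A‖ ≤ 1 is not enough; ‖A‖ ≤ 1/r with ‖Z‖ < r < R gives ‖S‖ < 1.
  obtain ⟨r, hr1, hr2⟩ := exists_between hZn
  have hr0 : 0 < r := (norm_nonneg Z).trans_lt hr1
  have hSn : ‖S‖ < 1 := by
    have hAn : ‖A‖ ≤ r⁻¹ := hA.norm_le hr0 (hseries.summable_norm_coeff hr0.le hr2)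
    calc ‖S‖ ≤ ‖tensor A (1 : Matrix (Fin n) (Fin n) ℂ)‖ * ‖D‖ := norm_mul_le _ _
      _ ≤ r⁻¹ * ‖Z‖ := mul_le_mul ((norm_tensor_one_right_le A).trans hAn) (norm_blockDiag_le Z)
          (norm_nonneg _) (by positivity)
      _ < 1 := by rwa [inv_mul_lt_iff₀ hr0, mul_one]
  obtain ⟨hu, hG⟩ := isUnit_and_hasSum_neg_inverse hSn h1 h2 hp
  refine ⟨hu, ?_⟩
  have hf := hseries.hasSum_homogeneous hZ
  -- The Neumann series starts in degree 1, so the constant term is split off.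
  rw [← hasSum_nat_add_iff' 1] at hf
  simp only [← hA.adjoint_Q_comp_pow] at hf
  have hsum : HasSum (fun k => (tensor (Q c) 1).adjoint ∘L (D * S ^ k) ∘L tensor (Q c) 1)
      ((tensor (Q c) 1).adjoint ∘L (-Ring.inverse (pencil c A Z)) ∘L tensor (Q c) 1) :=
    hasSum_comp_comp hG _ _
  have heq := hf.unique hsum
  rw [Finset.sum_range_one, Fintype.sum_unique, List.ofFn_zero, FreeMonoid.ofList_nil, seriesTerm,
    map_one, ContinuousLinearMap.neg_comp, ContinuousLinearMap.comp_neg] at heq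
  rw [sub_eq_add_neg, ← heq, add_sub_cancel]

end Realization

end NCRealization

end

/-! ### The main theorem -/

theorem mainTheorem6 {d : ℕ} {K : Type*} [NormedAddCommGroup K] [InnerProductSpace ℂ K]
    [CompleteSpace K] (ε : ℝ) (hε : 0 < ε)
    (c : NCRealization.Word d → (K →L[ℂ] K))
    (f : ∀ n : ℕ, NCRealization.Tuple d n →
      (NCRealization.Amp n K →L[ℂ] NCRealization.Amp n K))
    (hmono : NCRealization.MatrixMonotoneOn (NCRealization.realBall d (1 + ε)) f)
    (hseries : NCRealization.HasPowerSeriesOnComplexBall c f (1 + ε)) :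
    ∃ _ : ∀ i : Fin d, Fact (NCRealization.localizingMatrix c i).PosSemidef,
      (∃! A : NCRealization.H c →L[ℂ] NCRealization.H c, NCRealization.IsShift c A) ∧
      ∀ A : NCRealization.H c →L[ℂ] NCRealization.H c, NCRealization.IsShift c A →
        (∀ (α : NCRealization.Word d) (v : K), A (NCRealization.sym c α v) =
          ∑ i, NCRealization.sym c (FreeMonoid.of i * α) v) ∧
        IsSelfAdjoint A ∧ ‖A‖ ≤ 1 ∧
        ∀ n : ℕ, ∀ Z ∈ NCRealization.complexBall d (1 + ε) n, (∀ i, IsUnit (Z i)) →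
          IsUnit (NCRealization.pencil c A Z) ∧
          f n Z = NCRealization.tensor (c 1) 1 -
            (NCRealization.tensor (NCRealization.Q c) 1).adjoint ∘L
              Ring.inverse (NCRealization.pencil c A Z) ∘L
              NCRealization.tensor (NCRealization.Q c) 1 := by
  have hinst : ∀ i : Fin d, Fact (NCRealization.localizingMatrix c i).PosSemidef :=
    fun i => ⟨NCRealization.posSemidef_localizingMatrix hε hmono hseries i⟩
  have hc : Summable fun α => ‖c α‖ * (1 : ℝ) ^ FreeMonoid.length α :=
    hseries.summable_norm_coeff zero_le_one (by linarith)
  refine ⟨hinst, ?_, fun A hA => ⟨hA.apply_sym, hA.isSelfAdjoint, ?_, fun n Z hZ hZu =>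
    hA.realization (by linarith) hseries hZ hZu⟩⟩
  · obtain ⟨A, hA⟩ := NCRealization.exists_isShift c one_pos hc
    exact ⟨A, hA, fun A' hA' => hA'.unique hA⟩
  · simpa using hA.norm_le one_pos hc
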